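/- Let $\mathcal F^2$ be the Fock space, i.e. the Hilbert space of all entire functions $f$ with $\|f\|^2=\frac1\pi\int_{\mathbb C}|f(z)|^2e^{-|z|^2}\,dV(z)<\infty$, where $dV$ is Lebesgue measure on $\mathbb C$, with the inner product $\langle f,g\rangle=\frac1\pi\int_{\mathbb C}f(z)\overline{g(z)}e^{-|z|^2}\,dV(z)$. Let $\psi,\varphi:\mathbb C\to\mathbb C$ be entire functions with $\psi\not\equiv0$, and let $W_{\psi,\varphi,\max}$ be the maximal weighted composition operator on $\mathcal F^2$: its domain is $\{f\in\mathcal F^2:\psi\cdot(f\circ\varphi)\in\mathcal F^2\}$, and $W_{\psi,\varphi,\max}f=\psi\cdot(f\circ\varphi)$ for $f$ in this domain. An operator $T$ on a Hilbert space is called normal if it is closed and densely defined, $\operatorname{dom}(T)=\operatorname{dom}(T^*)$, and $\|Tx\|=\|T^*x\|$ for all $x\in\operatorname{dom}(T)$. Theorem 6.3. The following assertions are equivalent. (1) The operator $W_{\psi,\varphi,\max}$ is normal. (2) One of the following cases occurs: (a) there are $A,B,C,D\in\mathbb C$ with $A\ne1$ such that $\varphi(z)=Az+B$ and $\psi(z)=Ce^{Dz}$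 for all $z\in\mathbb C$, where $D=\overline B(1-A)(1-\overline A)^{-1}$; (b) there are $B,C,D\in\mathbb C$ such that $\varphi(z)=z+B$ and $\psi(z)=Ce^{Dz}$ for all $z\in\mathbb C$, where $|B|=|D|$. -/

import Mathlib

open MeasureTheory Filter Topology ComplexConjugate

noncomputable section

namespace Fock

/-- The Gaussian measure `(1/π) exp(-|z|²) dV(z)` on `ℂ`. -/
def gaussianMeasure : Measure ℂ :=
  (volume : Measure ℂ).withDensity
    (fun z => ENNReal.ofReal ((1 / Real.pi) * Real.exp (-‖z‖ ^ 2)))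

/-- The entire functions that are square integrable for the Gaussian measure. -/
def fockSubmodule : Submodule ℂ (ℂ → ℂ) where
  carrier := {f | Differentiable ℂ f ∧ MemLp f 2 gaussianMeasure}
  zero_mem' := ⟨differentiable_const 0, MemLp.zero⟩
  add_mem' := fun hf hg => ⟨hf.1.add hg.1, hf.2.add hg.2⟩
  smul_mem' := fun c _ hf => ⟨hf.1.const_smul c, hf.2.const_smul c⟩

/-- The Fock space `F²`. (A separate type, so that it carries the Hilbert space topology and not
the topology of pointwise convergence of `ℂ → ℂ`.) -/
def FockSpace : Type := fockSubmodule

namespace FockSpace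

instance : AddCommGroup FockSpace := inferInstanceAs (AddCommGroup fockSubmodule)

instance : Module ℂ FockSpace := inferInstanceAs (Module ℂ fockSubmodule)

instance : CoeFun FockSpace (fun _ => ℂ → ℂ) := ⟨fun f => f.1⟩

theorem differentiable (f : FockSpace) : Differentiable ℂ f := f.2.1

theorem memLp (f : FockSpace) : MemLp f 2 gaussianMeasure := f.2.2

@[ext] theorem ext {f g : FockSpace} (h : ∀ z, f z = g z) : f = g :=
  Subtype.ext (funext h)

@[simp] theorem add_apply (f g : FockSpace) (z : ℂ) : (f + g) z = f z + g z := rfl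

@[simp] theorem smul_apply (c : ℂ) (f : FockSpace) (z : ℂ) : (c • f) z = c * f z := rfl

@[simp] theorem zero_apply (z : ℂ) : (0 : FockSpace) z = 0 := rfl

/-- The class of an element of the Fock space in `L²` of the Gaussian measure. -/
def toL2 : FockSpace →ₗ[ℂ] Lp ℂ 2 gaussianMeasure where
  toFun f := f.memLp.toLp f
  map_add' f g := MemLp.toLp_add f.memLp g.memLp
  map_smul' c f := MemLp.toLp_const_smul c f.memLp

theorem coeFn_toL2 (f : FockSpace) : toL2 f =ᵐ[gaussianMeasure] f := f.memLp.coeFn_toLp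

theorem inner_toL2 (f g : FockSpace) :
    inner ℂ (toL2 f) (toL2 g) = ∫ z, conj (f z) * g z ∂gaussianMeasure := by
  rw [L2.inner_def]
  refine integral_congr_ae ?_
  filter_upwards [coeFn_toL2 f, coeFn_toL2 g] with z h1 h2
  rw [h1, h2, RCLike.inner_apply, mul_comm]

theorem volume_absolutelyContinuous : (volume : Measure ℂ) ≪ gaussianMeasure := by
  refine withDensity_absolutelyContinuous' (by fun_prop) (Eventually.of_forall fun z => ?_)
  have : 0 < (1 / Real.pi) * Real.exp (-‖z‖ ^ 2) := by positivity
  simpa using this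

theorem toL2_injective : Function.Injective toL2 := by
  intro f g h
  have h1 : f =ᵐ[gaussianMeasure] g :=
    (coeFn_toL2 f).symm.trans (h ▸ coeFn_toL2 g)
  have h2 : (f : ℂ → ℂ) =ᵐ[volume] g := volume_absolutelyContinuous.ae_le h1
  exact Subtype.ext
    ((Continuous.ae_eq_iff_eq volume f.differentiable.continuous g.differentiable.continuous).1 h2)

/-- The inner product of the Fock space. As everywhere in Mathlib it is linear in the second
variable: `inner ℂ f g = (1/π) ∫ conj (f z) g(z) exp(-|z|²) dV(z)`. -/
abbrev core : InnerProductSpace.Core ℂ FockSpace where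
  inner f g := ∫ z, conj (f z) * g z ∂gaussianMeasure
  conj_inner_symm f g := by
    rw [← inner_toL2, ← inner_toL2]; exact inner_conj_symm _ _
  re_inner_nonneg f := by
    rw [← inner_toL2]; exact inner_self_nonneg
  add_left f g h := by
    rw [← inner_toL2, ← inner_toL2, ← inner_toL2, map_add]; exact inner_add_left _ _ _
  smul_left f g c := by
    rw [← inner_toL2, ← inner_toL2, map_smul]; exact inner_smul_left _ _ _
  definite f h := by
    rw [← inner_toL2] at h
    exact toL2_injective ((inner_self_eq_zero.1 h).trans (map_zero _).symm)

instance : NormedAddCommGroup FockSpace :=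
  InnerProductSpace.Core.toNormedAddCommGroup (cd := core)

instance : InnerProductSpace ℂ FockSpace := InnerProductSpace.ofCore core.toCore

theorem inner_eq (f g : FockSpace) :
    inner ℂ f g = ∫ z, conj (f z) * g z ∂gaussianMeasure := rfl

theorem norm_toL2 (f : FockSpace) : ‖toL2 f‖ = ‖f‖ := by
  rw [norm_eq_sqrt_re_inner (𝕜 := ℂ), norm_eq_sqrt_re_inner (𝕜 := ℂ), inner_toL2, inner_eq]

theorem enorm_sq_eq (f : FockSpace) :
    ‖f‖ₑ ^ 2 = ∫⁻ z, ‖f z‖ₑ ^ 2 ∂gaussianMeasure := by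
  have h : ‖f‖ₑ = eLpNorm f 2 gaussianMeasure := by
    rw [← Lp.enorm_toLp (hf := f.memLp)]
    exact enorm_eq_iff_norm_eq.2 (norm_toL2 f).symm
  have h2 := eLpNorm_nnreal_pow_eq_lintegral (f := f) (μ := gaussianMeasure) (p := 2) (by norm_num)
  rw [h]
  simpa using h2

theorem lintegral_gaussianMeasure {F : ℂ → ENNReal} (hF : Measurable F) :
    ∫⁻ z, F z ∂gaussianMeasure
      = ∫⁻ z, ENNReal.ofReal ((1 / Real.pi) * Real.exp (-‖z‖ ^ 2)) * F z := by
  rw [gaussianMeasure, lintegral_withDensity_eq_lintegral_mul _ (by fun_prop) hF]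
  rfl

theorem enorm_zero_le_circle {g : ℂ → ℂ} (hg : Differentiable ℂ g) (r : ℝ) :
    ENNReal.ofReal (2 * Real.pi) * ‖g 0‖ₑ ≤
      ∫⁻ θ in Set.Ioo (-Real.pi) Real.pi, ‖g (Complex.polarCoord.symm (r, θ))‖ₑ := by
  have h1 : Real.circleAverage g 0 r = g 0 := hg.diffContOnCl.circleAverage
  have hper : Function.Periodic (fun θ => g (circleMap 0 r θ)) (2 * Real.pi) :=
    fun θ => by simp only [periodic_circleMap 0 r θ]
  have h2 : ∫ θ in (-Real.pi)..Real.pi, g (circleMap 0 r θ) = (2 * Real.pi) • g 0 := by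
    have h3 := hper.intervalIntegral_add_eq (-Real.pi) 0
    rw [show -Real.pi + 2 * Real.pi = Real.pi by ring, zero_add] at h3
    rw [h3, ← h1, Real.circleAverage_def, smul_smul,
      mul_inv_cancel₀ (by positivity), one_smul]
  rw [intervalIntegral.integral_of_le (by linarith [Real.pi_pos]), integral_Ioc_eq_integral_Ioo]
    at h2
  have h4 : ‖(2 * Real.pi) • g 0‖ₑ = ENNReal.ofReal (2 * Real.pi) * ‖g 0‖ₑ := by
    rw [enorm_smul, Real.enorm_eq_ofReal (by positivity)]
  rw [← h4, ← h2]
  refine (enorm_integral_le_lintegral_enorm _).trans (le_of_eq ?_)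
  refine lintegral_congr fun θ => ?_
  simp [circleMap, Complex.polarCoord_symm_apply, Complex.exp_mul_I]

theorem lintegral_radial :
    ∫⁻ r in Set.Ioi (0 : ℝ), ENNReal.ofReal (r * ((1 / Real.pi) * Real.exp (-r ^ 2)))
      = ENNReal.ofReal (2 * Real.pi)⁻¹ := by
  have h := integral_mul_cexp_neg_mul_sq (b := 1) (by simp)
  have h2 : ∫ r in Set.Ioi (0 : ℝ), r * Real.exp (-r ^ 2) = 1 / 2 := by
    have : ((∫ r in Set.Ioi (0 : ℝ), r * Real.exp (-r ^ 2) : ℝ) : ℂ) = ((1 / 2 : ℝ) : ℂ) := by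
      rw [← integral_complex_ofReal]
      simpa using h
    exact_mod_cast this
  have hi : IntegrableOn (fun r : ℝ => r * Real.exp (-r ^ 2)) (Set.Ioi 0) := by
    simpa using (integrable_mul_exp_neg_mul_sq (b := 1) one_pos).integrableOn
  have h3 : ∀ r : ℝ, r * ((1 / Real.pi) * Real.exp (-r ^ 2))
      = (1 / Real.pi) * (r * Real.exp (-r ^ 2)) := fun r => by ring
  simp_rw [h3]
  rw [← ofReal_integral_eq_lintegral_ofReal (hi.const_mul _), integral_const_mul, h2]
  · congr 1; field_simp
  · refine (ae_restrict_iff' measurableSet_Ioi).2 (Eventually.of_forall fun r hr => ?_)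
    have : (0 : ℝ) < r := hr
    positivity

theorem enorm_zero_le {g : ℂ → ℂ} (hg : Differentiable ℂ g) :
    ‖g 0‖ₑ ≤ ∫⁻ z, ‖g z‖ₑ ∂gaussianMeasure := by
  have hm : Measurable (fun z => ‖g z‖ₑ) := hg.continuous.measurable.enorm
  rw [lintegral_gaussianMeasure hm, ← Complex.lintegral_comp_polarCoord_symm, polarCoord_target,
    Measure.volume_eq_prod, setLIntegral_prod]
  · have hle : ∀ r ∈ Set.Ioi (0 : ℝ),
        ENNReal.ofReal (r * ((1 / Real.pi) * Real.exp (-r ^ 2))) *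
          (ENNReal.ofReal (2 * Real.pi) * ‖g 0‖ₑ) ≤
        ∫⁻ θ in Set.Ioo (-Real.pi) Real.pi, ENNReal.ofReal (r, θ).1 •
          (ENNReal.ofReal ((1 / Real.pi) *
            Real.exp (-‖Complex.polarCoord.symm (r, θ)‖ ^ 2)) *
            ‖g (Complex.polarCoord.symm (r, θ))‖ₑ) := by
      intro r hr
      refine (mul_le_mul_right (enorm_zero_le_circle hg r) _).trans ?_
      rw [← lintegral_const_mul' _ _ ENNReal.ofReal_ne_top]
      refine le_of_eq (lintegral_congr fun θ => ?_)
      have hr' : (0 : ℝ) < r := hr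
      rw [Complex.norm_polarCoord_symm, sq_abs, ENNReal.ofReal_mul hr'.le, smul_eq_mul, mul_assoc]
    refine le_trans ?_ (setLIntegral_mono' measurableSet_Ioi hle)
    rw [lintegral_mul_const' _ _ (ENNReal.mul_ne_top ENNReal.ofReal_ne_top enorm_ne_top),
      lintegral_radial, ← mul_assoc, ← ENNReal.ofReal_mul (by positivity),
      inv_mul_cancel₀ (by positivity), ENNReal.ofReal_one, one_mul]
  · have hp : Measurable Complex.polarCoord.symm := by
      have : (Complex.polarCoord.symm : ℝ × ℝ → ℂ)
          = fun p => (p.1 : ℂ) * (Real.cos p.2 + Real.sin p.2 * Complex.I) := by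
        funext p; exact Complex.polarCoord_symm_apply p
      rw [this]; fun_prop
    have h1 : Measurable (fun p => ‖g (Complex.polarCoord.symm p)‖ₑ) := hm.comp hp
    have h2 : Measurable (fun p => ‖Complex.polarCoord.symm p‖) := hp.norm
    simp only [smul_eq_mul]
    exact (by fun_prop : Measurable _).aemeasurable

/-- Point evaluations are bounded: `|f(w)| ≤ exp(|w|²/2) ‖f‖`. -/
theorem norm_apply_le (f : FockSpace) (w : ℂ) : ‖f w‖ ≤ Real.exp (‖w‖ ^ 2 / 2) * ‖f‖ := by
  have hd : Differentiable ℂ (fun z => (f (z + w) * Complex.exp (-(conj w * z))) ^ 2) := by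
    have := f.differentiable
    fun_prop
  have h := enorm_zero_le hd
  have hmf : Measurable (fun z => f z) := f.differentiable.continuous.measurable
  have key : ∫⁻ z, ‖(f (z + w) * Complex.exp (-(conj w * z))) ^ 2‖ₑ ∂gaussianMeasure
      = ENNReal.ofReal (Real.exp (‖w‖ ^ 2)) * ‖f‖ₑ ^ 2 := by
    rw [enorm_sq_eq, lintegral_gaussianMeasure (by fun_prop), lintegral_gaussianMeasure (by fun_prop),
      ← lintegral_const_mul' _ _ ENNReal.ofReal_ne_top,
      ← lintegral_add_right_eq_self
        (fun z => ENNReal.ofReal (Real.exp (‖w‖ ^ 2)) *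
          (ENNReal.ofReal ((1 / Real.pi) * Real.exp (-‖z‖ ^ 2)) * ‖f z‖ₑ ^ 2)) w]
    refine lintegral_congr fun z => ?_
    rw [enorm_pow, enorm_mul, mul_pow, ← mul_assoc, mul_right_comm, ← mul_assoc]
    congr 1
    rw [← ofReal_norm (Complex.exp _), Complex.norm_exp,
      ← ENNReal.ofReal_pow (by positivity), ← ENNReal.ofReal_mul (by positivity),
      ← ENNReal.ofReal_mul (by positivity)]
    congr 1
    rw [mul_left_comm, mul_assoc, ← Real.exp_nat_mul, ← Real.exp_add, ← Real.exp_add]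
    congr 2
    simp only [← Complex.normSq_eq_norm_sq, Complex.normSq_apply, Complex.add_re, Complex.add_im,
      Complex.neg_re, Complex.mul_re, Complex.conj_re, Complex.conj_im]
    push_cast
    ring
  rw [key] at h
  simp only [zero_add, mul_zero, neg_zero, Complex.exp_zero, mul_one, enorm_pow] at h
  rw [← ofReal_norm, ← ofReal_norm, ← ENNReal.ofReal_pow (norm_nonneg _),
    ← ENNReal.ofReal_pow (norm_nonneg _), ← ENNReal.ofReal_mul (by positivity),
    ENNReal.ofReal_le_ofReal_iff (by positivity)] at h
  refine abs_le_of_sq_le_sq' ?_ (by positivity) |>.2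
  rw [mul_pow, ← Real.exp_nat_mul]
  rwa [show ((2 : ℕ) : ℝ) * (‖w‖ ^ 2 / 2) = ‖w‖ ^ 2 by push_cast; ring]

instance : CompleteSpace FockSpace := by
  refine Metric.complete_of_cauchySeq_tendsto fun u hu => ?_
  have hpt : ∀ R : ℝ, UniformCauchySeqOn (fun n z => u n z) atTop (Metric.ball (0 : ℂ) R) := by
    intro R
    rw [Metric.uniformCauchySeqOn_iff]
    intro ε hε
    obtain ⟨N, hN⟩ := Metric.cauchySeq_iff.1 hu (ε / Real.exp (R ^ 2 / 2)) (by positivity)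
    refine ⟨N, fun m hm n hn z hz => ?_⟩
    have h1 : dist (u m) (u n) * Real.exp (R ^ 2 / 2) < ε :=
      (lt_div_iff₀ (Real.exp_pos _)).1 (hN m hm n hn)
    have h2 := norm_apply_le (u m - u n) z
    have hz' : ‖z‖ < R := by simpa using hz
    have h3 : Real.exp (‖z‖ ^ 2 / 2) ≤ Real.exp (R ^ 2 / 2) := by
      have := norm_nonneg z
      gcongr
    rw [dist_eq_norm] at h1 ⊢
    calc ‖u m z - u n z‖ ≤ Real.exp (‖z‖ ^ 2 / 2) * ‖u m - u n‖ := h2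
      _ ≤ Real.exp (R ^ 2 / 2) * ‖u m - u n‖ := by gcongr
      _ < ε := by rwa [mul_comm]
  have hlim : ∀ z, ∃ l, Tendsto (fun n => u n z) atTop (𝓝 l) := fun z =>
    cauchySeq_tendsto_of_complete
      ((hpt (‖z‖ + 1)).cauchySeq (by simp))
  choose v hv using hlim
  have hdiff : Differentiable ℂ v := by
    rw [← differentiableOn_univ]
    refine TendstoLocallyUniformlyOn.differentiableOn (F := fun n z => u n z) (φ := atTop) ?_
      (Eventually.of_forall fun n => (u n).differentiable.differentiableOn) isOpen_univ
    rw [tendstoLocallyUniformlyOn_univ]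
    intro s hs z
    refine ⟨Metric.ball 0 (‖z‖ + 1), Metric.isOpen_ball.mem_nhds (by simp), ?_⟩
    exact (hpt (‖z‖ + 1)).tendstoUniformlyOn_of_tendsto (fun x _ => hv x) s hs
  have hiso : Isometry toL2 := AddMonoidHomClass.isometry_of_norm toL2 norm_toL2
  obtain ⟨L, hL⟩ := cauchySeq_tendsto_of_complete (hiso.uniformContinuous.comp_cauchySeq hu)
  obtain ⟨ns, hns, hae⟩ := (tendstoInMeasure_of_tendsto_Lp hL).exists_seq_tendsto_ae
  have hall : ∀ᵐ z ∂gaussianMeasure, ∀ n, toL2 (u n) z = u n z :=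
    ae_all_iff.2 fun n => coeFn_toL2 (u n)
  have hLv : L =ᵐ[gaussianMeasure] v := by
    filter_upwards [hae, hall] with z h1 h2
    refine tendsto_nhds_unique h1 ?_
    simp only [Function.comp_apply, h2]
    exact (hv z).comp hns.tendsto_atTop
  let F : FockSpace := ⟨v, hdiff, (memLp_congr_ae hLv).1 (Lp.memLp L)⟩
  have hF : toL2 F = L := Lp.ext ((coeFn_toL2 F).trans hLv.symm)
  refine ⟨F, ?_⟩
  rw [hiso.isEmbedding.tendsto_nhds_iff, hF]
  exact hL

end FockSpace

/-- The maximal weighted composition operator on the Fock space: its domain consists of all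
`f ∈ F²` with `ψ · (f ∘ φ) ∈ F²`, and there it maps `f` to `ψ · (f ∘ φ)`. -/
def maximalWCO (ψ φ : ℂ → ℂ) : FockSpace →ₗ.[ℂ] FockSpace where
  domain :=
    { carrier := {f | (fun z => ψ z * f (φ z)) ∈ fockSubmodule}
      zero_mem' := by
        have h : (fun z => ψ z * (0 : FockSpace) (φ z)) = 0 := by funext z; simp
        rw [Set.mem_ofPred_eq, h]
        exact fockSubmodule.zero_mem
      add_mem' := fun {f g} hf hg => by
        have h : (fun z => ψ z * (f + g) (φ z))
            = (fun z => ψ z * f (φ z)) + (fun z => ψ z * g (φ z)) := by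
          funext z; simp [mul_add]
        rw [Set.mem_ofPred_eq, h]
        exact fockSubmodule.add_mem hf hg
      smul_mem' := fun c f hf => by
        have h : (fun z => ψ z * (c • f) (φ z)) = c • (fun z => ψ z * f (φ z)) := by
          funext z; simp [mul_left_comm]
        rw [Set.mem_ofPred_eq, h]
        exact fockSubmodule.smul_mem c hf }
  toFun :=
    { toFun := fun f => ⟨fun z => ψ z * f.1 (φ z), f.2⟩
      map_add' := fun f g => FockSpace.ext fun z => by
        change ψ z * (f.1 (φ z) + g.1 (φ z)) = ψ z * f.1 (φ z) + ψ z * g.1 (φ z)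
        ring
      map_smul' := fun c f => FockSpace.ext fun z => by
        change ψ z * (c * f.1 (φ z)) = c * (ψ z * f.1 (φ z))
        ring }

/-- A (possibly unbounded) operator `T` on a Hilbert space is normal if it is closed and densely
defined, `dom T = dom T*`, and `‖T x‖ = ‖T* x‖` for all `x` in this domain. -/
def IsNormalOperator {H : Type*} [NormedAddCommGroup H] [InnerProductSpace ℂ H] [CompleteSpace H]
    (T : H →ₗ.[ℂ] H) : Prop :=
  T.IsClosed ∧ Dense (T.domain : Set H) ∧ T.domain = T.adjoint.domain ∧
    ∀ (x : H) (hx : x ∈ T.domain) (hx' : x ∈ T.adjoint.domain), ‖T ⟨x, hx⟩‖ = ‖T.adjoint ⟨x, hx'⟩‖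

end Fock

end

/-! Write `T` for the operator and `K_w` for the reproducing kernel. The reproducing property gives
`T* K_w = conj (ψ w) • K_{φ w}`.

Necessity. Normality puts every `K_w` in the domain and gives `‖T K_w‖ = |ψ w| ‖K_{φ w}‖`. A zero of
`ψ` would make some `T K_w` vanish, so `ψ = exp q`. The bound on point evaluations yields `Re (q +
conj w * φ) ≤ |z|²/2 + c_w` for every `w`; by Borel–Carathéodory and Cauchy, `q` and `φ` have degree
at most two, and letting `w` be large forces `φ` to be affine. The norm identity is now a Gaussian
integral identity in `w`: it kills the quadratic part of `q` (`quadraticCoeff_eq_zero`) and gives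
the relations between `A, B, D` (`linearCoeff_relations`).

Sufficiency. For `ψ = C exp (D z)`, `φ = A z + B`, testing on kernels shows that `T*` is a
restriction of the operator `T'` of the same kind with parameters `conj A, conj D, conj C, conj B`.
A rigid motion of the plane matches the integrals for `‖T f‖` and `‖T' f‖`, finite or not. What
remains is that `T` and `T'` are formally adjoint. If `T` is defined everywhere, it is bounded and
kernels suffice. If `|A| > 1`, `T` has a bounded inverse of the same kind. If `A = 1`, `T` is a
limit of bounded operators with `A = r < 1`. -/

namespace Fock

/-! ### Norms as Gaussian integrals, and affine changes of variables -/

/-- The squared norm `(1/π) ∫ |f(z)|² exp(-|z|²) dV(z)`, possibly infinite. -/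
noncomputable def fockIntegral (f : ℂ → ℂ) : ENNReal :=
  ∫⁻ z, ENNReal.ofReal ((1 / Real.pi) * (‖f z‖ ^ 2 * Real.exp (-‖z‖ ^ 2)))

theorem lintegral_enorm_sq_gaussianMeasure {f : ℂ → ℂ} (hf : Continuous f) :
    ∫⁻ z, ‖f z‖ₑ ^ 2 ∂gaussianMeasure = fockIntegral f := by
  have hm : Measurable f := hf.measurable
  rw [FockSpace.lintegral_gaussianMeasure (by fun_prop), fockIntegral]
  refine lintegral_congr fun z => ?_
  rw [← ofReal_norm, ← ENNReal.ofReal_pow (norm_nonneg _), ← ENNReal.ofReal_mul (by positivity)]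
  congr 1
  ring

theorem mem_fockSubmodule_iff {f : ℂ → ℂ} (hf : Differentiable ℂ f) :
    f ∈ fockSubmodule ↔ fockIntegral f ≠ ⊤ := by
  have h2 := eLpNorm_nnreal_pow_eq_lintegral (f := f) (μ := gaussianMeasure) (p := 2) (by norm_num)
  have h3 : eLpNorm f 2 gaussianMeasure ^ 2 = fockIntegral f := by
    rw [← lintegral_enorm_sq_gaussianMeasure hf.continuous]
    simpa using h2
  rw [← h3]
  constructor
  · exact fun h => ENNReal.pow_ne_top h.2.2.ne
  · intro h
    refine ⟨hf, hf.continuous.aestronglyMeasurable, lt_top_iff_ne_top.2 fun ht => h ?_⟩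
    simp [ht]

namespace FockSpace

theorem enorm_sq_eq_fockIntegral (f : FockSpace) : ‖f‖ₑ ^ 2 = fockIntegral f := by
  rw [enorm_sq_eq, lintegral_enorm_sq_gaussianMeasure f.differentiable.continuous]

theorem fockIntegral_ne_top (f : FockSpace) : fockIntegral f ≠ ⊤ :=
  (mem_fockSubmodule_iff f.differentiable).1 f.2

end FockSpace

/-- Multiplication by `A` has real Jacobian `‖A‖ ^ 2`, the algebra norm of `A` over `ℝ`. -/
theorem lintegral_comp_affine {F : ℂ → ENNReal} (hF : Measurable F) {A : ℂ} (hA : A ≠ 0) (b : ℂ) :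
    ∫⁻ z, F (A * z + b) = ENNReal.ofReal (‖A‖ ^ 2)⁻¹ * ∫⁻ z, F z := by
  have hdet : LinearMap.det (LinearMap.mulLeft ℝ A) = ‖A‖ ^ 2 := by
    have h := Algebra.norm_apply ℝ A
    rw [Algebra.norm_complex_apply, Complex.normSq_eq_norm_sq] at h
    exact h.symm
  have h0 : LinearMap.det (LinearMap.mulLeft ℝ A) ≠ 0 := by
    rw [hdet]; exact pow_ne_zero _ (norm_ne_zero_iff.2 hA)
  have h1 := Measure.map_linearMap_addHaar_eq_smul_addHaar (volume : Measure ℂ) h0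
  rw [hdet, abs_of_nonneg (by positivity)] at h1
  have h2 : ∫⁻ z, F (A * z + b) =
      ∫⁻ z, F (z + b) ∂(Measure.map (LinearMap.mulLeft ℝ A) volume) := by
    rw [lintegral_map (by fun_prop)
      (LinearMap.continuous_of_finiteDimensional (LinearMap.mulLeft ℝ A)).measurable]
    rfl
  rw [h2, h1, lintegral_smul_measure, lintegral_add_right_eq_self F b, smul_eq_mul]

theorem fockIntegral_le_of_comp_affine {f g : ℂ → ℂ} (hg : Continuous g) {A b : ℂ} (hA : A ≠ 0)
    {c : ℝ} (hc : 0 ≤ c) (h : ∀ z, ‖f z‖ ^ 2 * Real.exp (-‖z‖ ^ 2) ≤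
      c * (‖g (A * z + b)‖ ^ 2 * Real.exp (-‖A * z + b‖ ^ 2))) :
    fockIntegral f ≤ ENNReal.ofReal (c * (‖A‖ ^ 2)⁻¹) * fockIntegral g := by
  have hm : Measurable fun z =>
      ENNReal.ofReal ((1 / Real.pi) * (‖g z‖ ^ 2 * Real.exp (-‖z‖ ^ 2))) := by fun_prop
  rw [ENNReal.ofReal_mul hc, mul_assoc]
  unfold fockIntegral
  rw [← lintegral_comp_affine hm hA b, ← lintegral_const_mul' _ _ ENNReal.ofReal_ne_top]
  refine lintegral_mono fun z => ?_
  rw [← ENNReal.ofReal_mul hc]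
  refine ENNReal.ofReal_le_ofReal ?_
  rw [mul_left_comm c]
  exact mul_le_mul_of_nonneg_left (h z) (by positivity)

theorem fockIntegral_eq_of_comp_isometry {f g : ℂ → ℂ} (hg : Continuous g) {ω b : ℂ} (hω : ‖ω‖ = 1)
    {c : ℝ} (hc : 0 ≤ c) (h : ∀ z, ‖f z‖ ^ 2 * Real.exp (-‖z‖ ^ 2) =
      c * (‖g (ω * z + b)‖ ^ 2 * Real.exp (-‖ω * z + b‖ ^ 2))) :
    fockIntegral f = ENNReal.ofReal c * fockIntegral g := by
  have hm : Measurable fun z =>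
      ENNReal.ofReal ((1 / Real.pi) * (‖g z‖ ^ 2 * Real.exp (-‖z‖ ^ 2))) := by fun_prop
  have hω0 : ω ≠ 0 := norm_ne_zero_iff.1 (by rw [hω]; exact one_ne_zero)
  have h1 := lintegral_comp_affine hm hω0 b
  simp only [hω, one_pow, inv_one, ENNReal.ofReal_one, one_mul] at h1
  unfold fockIntegral
  rw [← h1, ← lintegral_const_mul' _ _ ENNReal.ofReal_ne_top]
  refine lintegral_congr fun z => ?_
  rw [h z, ← ENNReal.ofReal_mul hc, mul_left_comm]

theorem fockIntegral_const_mul (c : ℂ) (f : ℂ → ℂ) :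
    fockIntegral (fun z => c * f z) = ENNReal.ofReal (‖c‖ ^ 2) * fockIntegral f := by
  unfold fockIntegral
  rw [← lintegral_const_mul' _ _ ENNReal.ofReal_ne_top]
  refine lintegral_congr fun z => ?_
  rw [← ENNReal.ofReal_mul (by positivity), norm_mul]
  congr 1
  ring

/-! ### The reproducing kernel -/

theorem integral_exp_neg_norm_sq : ∫ z : ℂ, Real.exp (-‖z‖ ^ 2) = Real.pi := by
  have h := GaussianFourier.integral_rexp_neg_mul_sq_norm (V := ℂ) (b := 1) one_pos
  simpa using h

theorem integrable_exp_neg_norm_sq : Integrable fun z : ℂ => Real.exp (-‖z‖ ^ 2) := by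
  by_contra h
  have := integral_undef h
  rw [integral_exp_neg_norm_sq] at this
  exact Real.pi_ne_zero this

/-- The mean value property of entire functions with respect to the Gaussian weight. -/
theorem integral_exp_neg_norm_sq_mul {g : ℂ → ℂ} (hg : Differentiable ℂ g)
    (hi : Integrable fun z : ℂ => (Real.exp (-‖z‖ ^ 2) : ℂ) * g z) :
    ∫ z : ℂ, (Real.exp (-‖z‖ ^ 2) : ℂ) * g z = Real.pi * g 0 := by
  set H : ℂ → ℂ := fun z => (Real.exp (-‖z‖ ^ 2) : ℂ) * g z with hH
  have hHc : Continuous H := by have := hg.continuous; fun_prop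
  have hnc : ∀ θ : ℝ, ‖circleMap 0 1 θ‖ = 1 := fun θ => by simp
  -- The weight and Lebesgue measure are rotation invariant, so the integral equals its average over
  -- rotations; after exchanging the integrals, the mean value property on circles applies.
  have hmp : ∀ θ : ℝ, MeasurePreserving (fun z : ℂ => circleMap 0 1 θ * z) volume volume := by
    intro θ
    have := (rotation ⟨circleMap 0 1 θ, by simp [Submonoid.unitSphere]⟩).measurePreserving
    exact this
  have hemb : ∀ θ : ℝ, MeasurableEmbedding (fun z : ℂ => circleMap 0 1 θ * z) := by
    intro θ
    have := (rotation
      ⟨circleMap 0 1 θ, by simp [Submonoid.unitSphere]⟩).toHomeomorph.measurableEmbedding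
    exact this
  have hint : ∀ θ : ℝ, ∫ z, H (circleMap 0 1 θ * z) = ∫ z, H z := fun θ =>
    (hmp θ).integral_comp (hemb θ) H
  have hprod : Integrable (Function.uncurry fun (θ : ℝ) (z : ℂ) => H (circleMap 0 1 θ * z))
      ((volume.restrict (Set.Ioc 0 (2 * Real.pi))).prod volume) := by
    have hcont : Continuous (Function.uncurry fun (θ : ℝ) (z : ℂ) => H (circleMap 0 1 θ * z)) := by
      have h1 : Continuous fun p : ℝ × ℂ => circleMap 0 1 p.1 * p.2 :=
        ((continuous_circleMap 0 1).comp continuous_fst).mul continuous_snd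
      exact hHc.comp h1
    rw [integrable_prod_iff hcont.aestronglyMeasurable]
    refine ⟨Eventually.of_forall fun θ => ?_, ?_⟩
    · exact ((hmp θ).integrable_comp_emb (hemb θ)).2 hi
    · have : (fun θ : ℝ => ∫ z, ‖Function.uncurry
          (fun (θ : ℝ) (z : ℂ) => H (circleMap 0 1 θ * z)) (θ, z)‖) = fun _ => ∫ z, ‖H z‖ := by
        funext θ
        exact (hmp θ).integral_comp (hemb θ) fun z => ‖H z‖
      rw [this]
      exact integrable_const _
  have hswap := integral_integral_swap hprod
  have havg : ∀ z, ∫ θ in Set.Ioc 0 (2 * Real.pi), H (circleMap 0 1 θ * z)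
      = (2 * Real.pi : ℝ) * ((Real.exp (-‖z‖ ^ 2) : ℂ) * g 0) := by
    intro z
    have hd : Differentiable ℂ fun u => g (u * z) := by fun_prop
    have h1 : Real.circleAverage (fun u => g (u * z)) 0 1 = g (0 * z) :=
      hd.diffContOnCl.circleAverage
    rw [Real.circleAverage_def, intervalIntegral.integral_of_le (by positivity), zero_mul] at h1
    simp only [hH, norm_mul, hnc, one_mul]
    rw [integral_const_mul, ← h1, Complex.real_smul]
    have : (Real.pi : ℂ) ≠ 0 := by exact_mod_cast Real.pi_ne_zero
    generalize ∫ θ in Set.Ioc 0 (2 * Real.pi), g (circleMap 0 1 θ * z) = J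
    push_cast
    field_simp
  simp only [hint, havg] at hswap
  rw [integral_const, integral_const_mul, integral_mul_const, integral_complex_ofReal,
    integral_exp_neg_norm_sq] at hswap
  simp only [measureReal_restrict_apply_univ, Real.volume_real_Ioc, sub_zero,
    max_eq_left Real.two_pi_pos.le, Complex.real_smul] at hswap
  have h2 : ((2 * Real.pi : ℝ) : ℂ) ≠ 0 := by exact_mod_cast Real.two_pi_pos.ne'
  exact mul_left_cancel₀ h2 hswap

theorem fockIntegral_exp_mul (w : ℂ) :
    fockIntegral (fun z => Complex.exp (conj w * z)) ≠ ⊤ := by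
  have h1 : fockIntegral (fun _ => 1) ≠ ⊤ := by
    unfold fockIntegral
    rw [← ofReal_integral_eq_lintegral_ofReal]
    · exact ENNReal.ofReal_ne_top
    · simpa using integrable_exp_neg_norm_sq.const_mul (Real.pi)⁻¹
    · exact Eventually.of_forall fun z => by positivity
  -- Completing the square: `2 Re (conj w * z) - |z|² = |w|² - |z - w|²`.
  rw [fockIntegral_eq_of_comp_isometry (g := fun _ => 1) (ω := 1) (b := -w)
    (c := Real.exp (‖w‖ ^ 2)) continuous_const (by simp) (by positivity)]
  · exact ENNReal.mul_ne_top ENNReal.ofReal_ne_top h1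
  · intro z
    rw [Complex.norm_exp, ← Real.exp_nat_mul, ← Real.exp_add, norm_one, one_pow, one_mul,
      ← Real.exp_add]
    congr 1
    simp only [← Complex.normSq_eq_norm_sq, Complex.normSq_apply, Complex.add_re, Complex.add_im,
      Complex.neg_re, Complex.neg_im, Complex.mul_re, Complex.mul_im, Complex.conj_re,
      Complex.conj_im, Complex.one_re, Complex.one_im]
    push_cast
    ring

/-- The reproducing kernel `K_w(z) = exp(conj w * z)` of the Fock space. -/
noncomputable def kern (w : ℂ) : FockSpace :=
  ⟨fun z => Complex.exp (conj w * z),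
    (mem_fockSubmodule_iff (by fun_prop)).2 (fockIntegral_exp_mul w)⟩

@[simp] theorem kern_apply (w z : ℂ) : kern w z = Complex.exp (conj w * z) := rfl

/-- After the translation `z ↦ z + w`, the kernel and the weight combine to `exp (-|z|²)` times an
entire function with value `f w` at `0`, so the Gaussian mean value property applies. -/
theorem inner_kern (w : ℂ) (f : FockSpace) : inner ℂ (kern w) f = f w := by
  have hi : Integrable (fun z => conj (kern w z) * f z) gaussianMeasure := by
    refine (L2.integrable_inner (𝕜 := ℂ) (FockSpace.toL2 (kern w)) (FockSpace.toL2 f)).congr ?_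
    filter_upwards [FockSpace.coeFn_toL2 (kern w), FockSpace.coeFn_toL2 f] with z h1 h2
    rw [h1, h2, RCLike.inner_apply, mul_comm]
  have hdm : Measurable fun z : ℂ => ENNReal.ofReal ((1 / Real.pi) * Real.exp (-‖z‖ ^ 2)) := by
    fun_prop
  have hpos : ∀ z : ℂ, 0 ≤ (1 / Real.pi) * Real.exp (-‖z‖ ^ 2) := fun z => by positivity
  rw [FockSpace.inner_eq]
  unfold gaussianMeasure at hi ⊢
  rw [integrable_withDensity_iff_integrable_smul' hdm (by simp)] at hi
  rw [integral_withDensity_eq_integral_toReal_smul hdm (by simp)]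
  simp only [ENNReal.toReal_ofReal (hpos _), Complex.real_smul] at hi ⊢
  have key : ∀ z, (((1 / Real.pi) * Real.exp (-‖z + w‖ ^ 2) : ℝ) : ℂ) *
      (conj (kern w (z + w)) * f (z + w)) = (Real.pi : ℂ)⁻¹ *
        ((Real.exp (-‖z‖ ^ 2) : ℂ) * (Complex.exp (-(conj w * z)) * f (z + w))) := by
    intro z
    rw [kern_apply, ← Complex.exp_conj]
    push_cast
    have : Complex.exp (-(‖z + w‖ : ℂ) ^ 2) * Complex.exp (conj (conj w * (z + w)))
        = Complex.exp (-(‖z‖ : ℂ) ^ 2) * Complex.exp (-(conj w * z)) := by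
      rw [← Complex.exp_add, ← Complex.exp_add, ← Complex.mul_conj', ← Complex.mul_conj']
      congr 1
      simp only [map_mul, map_add, Complex.conj_conj]
      ring
    linear_combination (Real.pi : ℂ)⁻¹ * f (z + w) * this
  have hi2 := hi.comp_add_right w
  rw [← integral_add_right_eq_self _ w]
  simp only [key] at hi2 ⊢
  have hpi : (Real.pi : ℂ) ≠ 0 := by exact_mod_cast Real.pi_ne_zero
  have hd : Differentiable ℂ fun z => Complex.exp (-(conj w * z)) * f (z + w) := by
    have := f.differentiable
    fun_prop
  have hi3 := hi2.const_mul (Real.pi : ℂ)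
  simp only [mul_inv_cancel_left₀ hpi] at hi3
  rw [integral_const_mul, integral_exp_neg_norm_sq_mul hd hi3, inv_mul_cancel_left₀ hpi]
  simp

theorem inner_kern_right (f : FockSpace) (w : ℂ) : inner ℂ f (kern w) = conj (f w) := by
  rw [← inner_kern, inner_conj_symm]

theorem continuous_apply (w : ℂ) : Continuous fun f : FockSpace => f w := by
  simp only [← inner_kern]
  fun_prop

theorem norm_kern_sq (w : ℂ) : ‖kern w‖ ^ 2 = Real.exp (‖w‖ ^ 2) := by
  have h := inner_self_eq_norm_sq_to_K (𝕜 := ℂ) (kern w)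
  rw [inner_kern, kern_apply, Complex.conj_mul'] at h
  have h2 : ((Real.exp (‖w‖ ^ 2) : ℝ) : ℂ) = ((‖kern w‖ ^ 2 : ℝ) : ℂ) := by
    push_cast
    exact h
  exact_mod_cast h2.symm

/-- A vector orthogonal to all kernels vanishes at every point. -/
theorem dense_span_kern : Dense (Submodule.span ℂ (Set.range kern) : Set FockSpace) := by
  rw [Submodule.dense_iff_topologicalClosure_eq_top,
    Submodule.topologicalClosure_eq_top_iff, Submodule.eq_bot_iff]
  intro f hf
  refine FockSpace.ext fun w => ?_
  rw [← inner_kern]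
  exact (Submodule.mem_orthogonal _ _).1 hf _ (Submodule.subset_span ⟨w, rfl⟩)

theorem dense_of_kern_mem {U : Submodule ℂ FockSpace} (h : ∀ w, kern w ∈ U) :
    Dense (U : Set FockSpace) :=
  dense_span_kern.mono (Submodule.span_le.2 (by rintro _ ⟨w, rfl⟩; exact h w))

theorem continuousLinearMap_ext_kern {E : Type*} [NormedAddCommGroup E] [NormedSpace ℂ E]
    {S T : FockSpace →L[ℂ] E} (h : ∀ w, S (kern w) = T (kern w)) : S = T :=
  ContinuousLinearMap.ext_on dense_span_kern (by rintro _ ⟨w, rfl⟩; exact h w)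

/-! ### Closedness, boundedness and weak convergence -/

theorem mem_domain_maximalWCO {ψ φ : ℂ → ℂ} {f : FockSpace} :
    f ∈ (maximalWCO ψ φ).domain ↔ (fun z => ψ z * f (φ z)) ∈ fockSubmodule := Iff.rfl

@[simp] theorem maximalWCO_apply {ψ φ : ℂ → ℂ} (f : (maximalWCO ψ φ).domain) (z : ℂ) :
    maximalWCO ψ φ f z = ψ z * f.1 (φ z) := rfl

/-- Maximality of the domain makes the graph an intersection of pointwise conditions, each closed
because evaluations are continuous. -/
theorem isClosed_maximalWCO (ψ φ : ℂ → ℂ) : (maximalWCO ψ φ).IsClosed := by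
  have h : ((maximalWCO ψ φ).graph : Set (FockSpace × FockSpace)) =
      ⋂ z, {p : FockSpace × FockSpace | p.2 z = ψ z * p.1 (φ z)} := by
    ext ⟨f, g⟩
    simp only [SetLike.mem_coe, Set.mem_iInter, Set.mem_ofPred_eq]
    rw [LinearPMap.mem_graph_iff]
    constructor
    · rintro ⟨y, rfl, rfl⟩ z
      rfl
    · intro hz
      have hf : f ∈ (maximalWCO ψ φ).domain := by
        rw [mem_domain_maximalWCO, ← funext hz]
        exact g.2
      exact ⟨⟨f, hf⟩, rfl, FockSpace.ext fun z => (hz z).symm⟩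
  rw [LinearPMap.IsClosed, h]
  exact isClosed_iInter fun z => isClosed_eq ((continuous_apply z).comp continuous_snd)
    (continuous_const.mul ((continuous_apply (φ z)).comp continuous_fst))

/-- Closed graph theorem, again by continuity of evaluations. -/
theorem exists_continuousLinearMap_of_mem {ψ φ : ℂ → ℂ}
    (h : ∀ f : FockSpace, (fun z => ψ z * f (φ z)) ∈ fockSubmodule) :
    ∃ S : FockSpace →L[ℂ] FockSpace, ∀ f z, S f z = ψ z * f (φ z) := by
  let L : FockSpace →ₗ[ℂ] FockSpace :=
    { toFun := fun f => ⟨fun z => ψ z * f (φ z), h f⟩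
      map_add' := fun f g => FockSpace.ext fun z => mul_add _ _ _
      map_smul' := fun c f => FockSpace.ext fun z => mul_left_comm _ _ _ }
  refine ⟨⟨L, L.continuous_of_seq_closed_graph fun u x y hu hy => FockSpace.ext fun z => ?_⟩,
    fun f z => rfl⟩
  refine tendsto_nhds_unique (((continuous_apply z).tendsto y).comp hy) ?_
  exact (((continuous_apply (φ z)).tendsto x).comp hu).const_mul (ψ z)

theorem inner_map_eq_of_kern {S : FockSpace →L[ℂ] FockSpace} {y k : FockSpace}
    (h : ∀ w, inner ℂ y (S (kern w)) = conj (k w)) (x : FockSpace) :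
    inner ℂ y (S x) = inner ℂ k x := by
  have : (innerSL ℂ y).comp S = innerSL ℂ k := continuousLinearMap_ext_kern fun w => by
    simp only [ContinuousLinearMap.comp_apply, innerSL_apply_apply, h, inner_kern_right]
  simpa using congrArg (fun T : FockSpace →L[ℂ] ℂ => T x) this

/-- A bounded sequence of the Fock space that converges pointwise converges weakly. -/
theorem tendsto_inner_of_tendsto_apply {u : ℕ → FockSpace} {v : FockSpace} {M : ℝ}
    (hM : ∀ n, ‖u n‖ ≤ M) (hu : ∀ z, Tendsto (fun n => u n z) atTop (𝓝 (v z))) (y : FockSpace) :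
    Tendsto (fun n => inner ℂ (u n) y) atTop (𝓝 (inner ℂ v y)) := by
  have hM0 : 0 ≤ M := (norm_nonneg _).trans (hM 0)
  -- The functionals are uniformly Lipschitz, so the set of `y` where convergence holds is closed;
  -- on kernels it is pointwise convergence.
  have heq : UniformEquicontinuous fun n (y : FockSpace) => inner ℂ (u n) y := by
    refine LipschitzWith.uniformEquicontinuous _ ⟨M, hM0⟩ fun n =>
      LipschitzWith.of_dist_le_mul fun x y => ?_
    rw [dist_eq_norm, dist_eq_norm, ← inner_sub_right]
    exact (norm_inner_le_norm _ _).trans (mul_le_mul_of_nonneg_right (hM n) (norm_nonneg _))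
  have hcl := heq.equicontinuous.isClosed_setOfPred_tendsto (l := atTop)
    (f := fun y : FockSpace => inner ℂ v y) (by fun_prop)
  have hsub : (Submodule.span ℂ (Set.range kern) : Set FockSpace) ⊆
      {y | Tendsto (fun n => inner ℂ (u n) y) atTop (𝓝 (inner ℂ v y))} := by
    intro y hy
    induction hy using Submodule.span_induction with
    | mem y hy =>
      obtain ⟨w, rfl⟩ := hy
      simp only [Set.mem_ofPred_eq, inner_kern_right]
      exact (Complex.continuous_conj.tendsto _).comp (hu w)
    | zero => simp
    | add x y _ _ hx hy =>
      simp only [Set.mem_ofPred_eq, inner_add_right]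
      exact Tendsto.add hx hy
    | smul c x _ hx =>
      simp only [Set.mem_ofPred_eq, inner_smul_right]
      exact Tendsto.const_mul c hx
  exact hcl.closure_subset_iff.2 hsub (dense_span_kern y)

/-! ### Exponential weight and affine symbol: reduction to a formal adjoint -/

/-- The maximal weighted composition operator with symbols `C exp(D z)` and `A z + B`. -/
noncomputable abbrev expWCO (A B C D : ℂ) : FockSpace →ₗ.[ℂ] FockSpace :=
  maximalWCO (fun z => C * Complex.exp (D * z)) (fun z => A * z + B)

theorem exp_mul_kern_affine (A B C D w : ℂ) :
    (fun z => C * Complex.exp (D * z) * kern w (A * z + B)) =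
      (((C * Complex.exp (conj w * B)) • kern (conj D + w * conj A) : FockSpace) : ℂ → ℂ) := by
  funext z
  simp only [FockSpace.smul_apply, kern_apply, map_add, map_mul, Complex.conj_conj]
  rw [mul_assoc, mul_assoc, ← Complex.exp_add, ← Complex.exp_add]
  congr 2
  ring

theorem kern_mem_domain_expWCO (A B C D w : ℂ) : kern w ∈ (expWCO A B C D).domain := by
  rw [mem_domain_maximalWCO, exp_mul_kern_affine]
  exact Subtype.prop _

theorem expWCO_kern (A B C D w : ℂ) :
    expWCO A B C D ⟨kern w, kern_mem_domain_expWCO A B C D w⟩ =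
      (C * Complex.exp (conj w * B)) • kern (conj D + w * conj A) :=
  FockSpace.ext fun z => congrFun (exp_mul_kern_affine A B C D w) z

theorem inner_smul_kern_affine (A B C D w : ℂ) (y : FockSpace) :
    inner ℂ y ((C * Complex.exp (conj w * B)) • kern (conj D + w * conj A)) =
      conj (conj C * Complex.exp (conj B * w) * y (conj A * w + conj D)) := by
  rw [inner_smul_right, inner_kern_right, map_mul, map_mul, Complex.conj_conj,
    ← Complex.exp_conj, map_mul, Complex.conj_conj, add_comm, mul_comm w, mul_comm (conj w)]

theorem dense_domain_expWCO (A B C D : ℂ) : Dense ((expWCO A B C D).domain : Set FockSpace) :=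
  dense_of_kern_mem (kern_mem_domain_expWCO A B C D)

/-- The operator sends kernels to multiples of kernels, so pairing with them determines `T* y`
pointwise. -/
theorem adjoint_expWCO_le (A B C D : ℂ) :
    (expWCO A B C D).adjoint ≤ expWCO (conj A) (conj D) (conj C) (conj B) := by
  have key : ∀ (y : (expWCO A B C D).adjoint.domain) (w : ℂ), (expWCO A B C D).adjoint y w =
      conj C * Complex.exp (conj B * w) * y.1 (conj A * w + conj D) := by
    intro y w
    have h := LinearPMap.adjoint_isFormalAdjoint (dense_domain_expWCO A B C D) y
      ⟨kern w, kern_mem_domain_expWCO A B C D w⟩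
    rw [expWCO_kern, inner_smul_kern_affine, inner_kern_right] at h
    exact (starRingEnd ℂ).injective h
  refine ⟨fun y hy => ?_, fun y y' hyy => FockSpace.ext fun w => ?_⟩
  · rw [mem_domain_maximalWCO, ← funext (key ⟨y, hy⟩)]
    exact Subtype.prop _
  · rw [key y w, hyy, maximalWCO_apply]

theorem isFormalAdjoint_of_forall_mem {A B C D : ℂ}
    (h : ∀ f : FockSpace, f ∈ (expWCO A B C D).domain) :
    (expWCO A B C D).IsFormalAdjoint (expWCO (conj A) (conj D) (conj C) (conj B)) := by
  obtain ⟨S, hS⟩ := exists_continuousLinearMap_of_mem h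
  have hT : ∀ x, expWCO A B C D x = S x := fun x => FockSpace.ext fun z => (hS x.1 z).symm
  refine LinearPMap.IsFormalAdjoint.symm fun y x => ?_
  rw [hT]
  refine (inner_map_eq_of_kern (fun w => ?_) _).symm
  rw [← hT ⟨kern w, kern_mem_domain_expWCO A B C D w⟩, expWCO_kern, inner_smul_kern_affine]
  rfl

/-- As the norm identity is in `[0, ∞]`, it yields the equality of domains as well as of norms. -/
theorem isNormalOperator_expWCO {A B C D : ℂ}
    (hadj : (expWCO A B C D).IsFormalAdjoint (expWCO (conj A) (conj D) (conj C) (conj B)))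
    (hnorm : ∀ f : FockSpace,
      fockIntegral (fun z => C * Complex.exp (D * z) * f (A * z + B)) =
      fockIntegral (fun z => conj C * Complex.exp (conj B * z) * f (conj A * z + conj D))) :
    IsNormalOperator (expWCO A B C D) := by
  have hd := dense_domain_expWCO A B C D
  have hT : (expWCO A B C D).adjoint = expWCO (conj A) (conj D) (conj C) (conj B) :=
    le_antisymm (adjoint_expWCO_le A B C D) (hadj.le_adjoint hd)
  refine ⟨isClosed_maximalWCO _ _, hd, ?_, ?_⟩
  · rw [hT]
    ext f
    have hf := f.differentiable
    rw [mem_domain_maximalWCO, mem_domain_maximalWCO, mem_fockSubmodule_iff (by fun_prop),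
      mem_fockSubmodule_iff (by fun_prop), hnorm]
  · rw [hT]
    intro f h1 h2
    have h3 : ‖expWCO A B C D ⟨f, h1⟩‖ₑ ^ 2 =
        ‖expWCO (conj A) (conj D) (conj C) (conj B) ⟨f, h2⟩‖ₑ ^ 2 := by
      rw [FockSpace.enorm_sq_eq_fockIntegral, FockSpace.enorm_sq_eq_fockIntegral]
      exact hnorm f
    have h4 := congrArg ENNReal.toReal h3
    rw [ENNReal.toReal_pow, ENNReal.toReal_pow, toReal_enorm, toReal_enorm] at h4
    exact (sq_eq_sq₀ (norm_nonneg _) (norm_nonneg _)).1 h4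

theorem ofReal_two_re_sub_norm_sq (D z : ℂ) :
    ((2 * (D * z).re - ‖z‖ ^ 2 : ℝ) : ℂ) = D * z + conj D * conj z - z * conj z := by
  rw [Complex.mul_conj', Complex.ofReal_sub, ← Complex.add_conj, map_mul]
  push_cast
  rfl

theorem norm_sq_mul_exp_neg_norm_sq (C D y z : ℂ) :
    ‖C * Complex.exp (D * z) * y‖ ^ 2 * Real.exp (-‖z‖ ^ 2) =
      ‖C‖ ^ 2 * ‖y‖ ^ 2 * Real.exp (2 * (D * z).re - ‖z‖ ^ 2) := by
  rw [norm_mul, norm_mul, Complex.norm_exp, mul_pow, mul_pow, ← Real.exp_nat_mul,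
    sub_eq_add_neg, Real.exp_add]
  push_cast
  ring

theorem norm_sq_mul_exp_le {C D y z u : ℂ} {K : ℝ}
    (h : 2 * (D * z).re - ‖z‖ ^ 2 ≤ K - ‖u‖ ^ 2) :
    ‖C * Complex.exp (D * z) * y‖ ^ 2 * Real.exp (-‖z‖ ^ 2) ≤
      ‖C‖ ^ 2 * Real.exp K * (‖y‖ ^ 2 * Real.exp (-‖u‖ ^ 2)) := by
  rw [norm_sq_mul_exp_neg_norm_sq]
  calc _ ≤ ‖C‖ ^ 2 * ‖y‖ ^ 2 * Real.exp (K - ‖u‖ ^ 2) := by gcongr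
    _ = _ := by rw [sub_eq_add_neg, Real.exp_add]; ring

theorem mem_domain_expWCO_of_le {A B C D : ℂ} (hA : A ≠ 0) {K : ℝ}
    (h : ∀ z, 2 * (D * z).re - ‖z‖ ^ 2 ≤ K - ‖A * z + B‖ ^ 2) (f : FockSpace) :
    f ∈ (expWCO A B C D).domain := by
  have hf := f.differentiable
  rw [mem_domain_maximalWCO, mem_fockSubmodule_iff (by fun_prop)]
  refine ne_top_of_le_ne_top (ENNReal.mul_ne_top ENNReal.ofReal_ne_top f.fockIntegral_ne_top)
    (fockIntegral_le_of_comp_affine hf.continuous hA (b := B)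
      (c := ‖C‖ ^ 2 * Real.exp K) (by positivity) fun z => norm_sq_mul_exp_le (h z))

theorem norm_le_of_fockIntegral_le {f g : FockSpace} {c : ℝ} (hc : 0 ≤ c)
    (h : fockIntegral f ≤ ENNReal.ofReal c * fockIntegral g) : ‖f‖ ≤ Real.sqrt c * ‖g‖ := by
  rw [← FockSpace.enorm_sq_eq_fockIntegral, ← FockSpace.enorm_sq_eq_fockIntegral,
    ← ofReal_norm, ← ofReal_norm, ← ENNReal.ofReal_pow (norm_nonneg _),
    ← ENNReal.ofReal_pow (norm_nonneg _), ← ENNReal.ofReal_mul hc,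
    ENNReal.ofReal_le_ofReal_iff (by positivity)] at h
  refine (sq_le_sq₀ (norm_nonneg _) (by positivity)).1 ?_
  rwa [mul_pow, Real.sq_sqrt hc]

/-! ### Symbols with a fixed point `a` -/

section FixedPoint

variable {A a B C D : ℂ}

theorem mem_domain_expWCO_of_fixed (hA : ‖A‖ ≤ 1) (hB : B = a * (1 - A))
    (hD : D = conj a * (1 - A)) (f : FockSpace) : f ∈ (expWCO A B C D).domain := by
  -- For `A = 0` no change of variables is available, but the image is a multiple of one kernel.
  rcases eq_or_ne A 0 with rfl | hA0
  · have h : (fun z => C * Complex.exp (D * z) * f (0 * z + B)) =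
        (((C * f B) • kern (conj D) : FockSpace) : ℂ → ℂ) := by
      funext z
      simp only [FockSpace.smul_apply, kern_apply, Complex.conj_conj, zero_mul, zero_add]
      ring
    rw [mem_domain_maximalWCO, h]
    exact Subtype.prop _
  · refine mem_domain_expWCO_of_le hA0 (K := 2 * ‖a‖ ^ 2 * (1 - A.re)) (fun z => ?_) f
    -- Completing the square around the fixed point; `‖A‖ ≤ 1` gives the defect its sign.
    have h1 : 2 * (D * z).re - ‖z‖ ^ 2 = 2 * ‖a‖ ^ 2 * (1 - A.re) - ‖A * z + B‖ ^ 2 -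
        (1 - ‖A‖ ^ 2) * ‖z - a‖ ^ 2 := by
      rw [hB, hD]
      simp only [← Complex.normSq_eq_norm_sq, Complex.normSq_apply, Complex.add_re, Complex.add_im,
        Complex.sub_re, Complex.sub_im, Complex.mul_re, Complex.mul_im, Complex.conj_re,
        Complex.conj_im, Complex.one_re, Complex.one_im]
      ring
    have h2 : 0 ≤ (1 - ‖A‖ ^ 2) * ‖z - a‖ ^ 2 := by
      have : ‖A‖ ^ 2 ≤ 1 := pow_le_one₀ (norm_nonneg _) hA
      have := sq_nonneg ‖z - a‖
      nlinarith
    linarith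

theorem isFormalAdjoint_expWCO_of_fixed (hB : B = a * (1 - A)) (hD : D = conj a * (1 - A))
    (hC : C ≠ 0) :
    (expWCO A B C D).IsFormalAdjoint (expWCO (conj A) (conj D) (conj C) (conj B)) := by
  rcases le_or_gt ‖A‖ 1 with hA | hA
  · exact isFormalAdjoint_of_forall_mem fun f => mem_domain_expWCO_of_fixed hA hB hD f
  have hA0 : A ≠ 0 := norm_pos_iff.1 (one_pos.trans hA)
  have hA' : ‖A⁻¹‖ ≤ 1 := by rw [norm_inv]; exact inv_le_one_of_one_le₀ hA.le
  have hB' : -B * A⁻¹ = a * (1 - A⁻¹) := by rw [hB]; field_simp; ring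
  have hD' : -D * A⁻¹ = conj a * (1 - A⁻¹) := by rw [hD]; field_simp; ring
  -- For `‖A‖ > 1` the inverse has multiplier `A⁻¹` and the same fixed point, so it is everywhere
  -- defined; `C'` normalizes its weight. Its adjoint relation, applied to `T x` and `k = T' y`, is
  -- the one sought.
  set C' : ℂ := C⁻¹ * Complex.exp (D * B * A⁻¹) with hC'
  have hdom : ∀ f : FockSpace, f ∈ (expWCO A⁻¹ (-B * A⁻¹) C' (-D * A⁻¹)).domain :=
    fun f => mem_domain_expWCO_of_fixed hA' hB' hD' f
  have hpair := isFormalAdjoint_of_forall_mem hdom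
  intro x y
  have hST : expWCO A⁻¹ (-B * A⁻¹) C' (-D * A⁻¹) ⟨expWCO A B C D x, hdom _⟩ = x := by
    refine FockSpace.ext fun z => ?_
    simp only [maximalWCO_apply]
    have h1 : A * (A⁻¹ * z + -B * A⁻¹) + B = z := by field_simp; ring
    have h2 : C' * Complex.exp (-D * A⁻¹ * z) *
        (C * Complex.exp (D * (A⁻¹ * z + -B * A⁻¹))) = 1 := by
      rw [hC']
      have h3 : Complex.exp (D * B * A⁻¹) * Complex.exp (-D * A⁻¹ * z) *
          Complex.exp (D * (A⁻¹ * z + -B * A⁻¹)) = 1 := by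
        rw [← Complex.exp_add, ← Complex.exp_add, ← Complex.exp_zero]
        congr 1
        ring
      have h4 : C⁻¹ * C = 1 := inv_mul_cancel₀ hC
      linear_combination (C⁻¹ * C) * h3 + h4
    rw [h1, ← mul_assoc, h2, one_mul]
  set k := expWCO (conj A) (conj D) (conj C) (conj B) y with hk
  have hSk : (fun z => conj C' * Complex.exp (conj (-B * A⁻¹) * z) *
      k (conj A⁻¹ * z + conj (-D * A⁻¹))) = (y : FockSpace) := by
    funext z
    rw [hk, maximalWCO_apply]
    have hcA : conj A ≠ 0 := (map_ne_zero _).2 hA0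
    have h1 : conj A * (conj A⁻¹ * z + conj (-D * A⁻¹)) + conj D = z := by
      simp only [map_mul, map_neg, map_inv₀]; field_simp; ring
    have h2 : conj C' * Complex.exp (conj (-B * A⁻¹) * z) *
        (conj C * Complex.exp (conj B * (conj A⁻¹ * z + conj (-D * A⁻¹)))) = 1 := by
      rw [hC', map_mul, ← Complex.exp_conj]
      have h3 : Complex.exp (conj (D * B * A⁻¹)) * Complex.exp (conj (-B * A⁻¹) * z) *
          Complex.exp (conj B * (conj A⁻¹ * z + conj (-D * A⁻¹))) = 1 := by
        rw [← Complex.exp_add, ← Complex.exp_add, ← Complex.exp_zero]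
        congr 1
        simp only [map_mul, map_neg]
        ring
      have h4 : conj C⁻¹ * conj C = 1 := by rw [← map_mul, inv_mul_cancel₀ hC, map_one]
      linear_combination (conj C⁻¹ * conj C) * h3 + h4
    rw [h1, ← mul_assoc, h2, one_mul]
  have hkdom : k ∈ (expWCO (conj A⁻¹) (conj (-D * A⁻¹)) (conj C') (conj (-B * A⁻¹))).domain := by
    rw [mem_domain_maximalWCO, hSk]
    exact Subtype.prop _
  have h := hpair ⟨expWCO A B C D x, hdom _⟩ ⟨k, hkdom⟩
  rw [hST] at h
  rw [h]
  congr 1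
  exact FockSpace.ext fun z => (congrFun hSk z).symm

/-- The rotation about `a` by `ω = A / conj A` carries one integrand to the other. -/
theorem fockIntegral_expWCO_of_fixed (hB : B = a * (1 - A)) (hD : D = conj a * (1 - A))
    {f : ℂ → ℂ} (hf : Continuous f) :
    fockIntegral (fun z => C * Complex.exp (D * z) * f (A * z + B)) =
      fockIntegral (fun z => conj C * Complex.exp (conj B * z) * f (conj A * z + conj D)) := by
  obtain ⟨ω, hω, hAω⟩ : ∃ ω : ℂ, ‖ω‖ = 1 ∧ conj A * ω = A := by
    rcases eq_or_ne A 0 with rfl | hA0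
    · exact ⟨1, by simp, by simp⟩
    · refine ⟨A / conj A, ?_, mul_div_cancel₀ _ ((map_ne_zero _).2 hA0)⟩
      rw [norm_div, RCLike.norm_conj, div_self (norm_ne_zero_iff.2 hA0)]
  have hAω' : A * conj ω = conj A := by
    have := congrArg conj hAω
    simpa using this
  have hωω : ω * conj ω = 1 := by rw [Complex.mul_conj', hω]; norm_num
  rw [fockIntegral_eq_of_comp_isometry (f := fun z => C * Complex.exp (D * z) * f (A * z + B))
    (g := fun z => conj C * Complex.exp (conj B * z) * f (conj A * z + conj D))
    (ω := ω) (b := a * (1 - ω)) (c := 1) (by fun_prop) hω zero_le_one, ENNReal.ofReal_one, one_mul]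
  intro z
  have harg : conj A * (ω * z + a * (1 - ω)) + conj D = A * z + B := by
    rw [hD, hB]
    simp only [map_mul, Complex.conj_conj, map_sub, map_one]
    linear_combination (z - a) * hAω
  have hexp : 2 * (D * z).re - ‖z‖ ^ 2 =
      2 * (conj B * (ω * z + a * (1 - ω))).re - ‖ω * z + a * (1 - ω)‖ ^ 2 := by
    apply Complex.ofReal_injective
    rw [ofReal_two_re_sub_norm_sq, ofReal_two_re_sub_norm_sq, hD, hB]
    simp only [map_mul, Complex.conj_conj, map_sub, map_one, map_add]
    linear_combination (z - a) * (conj z - conj a) * hωω + conj a * (z - a) * hAω +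
      a * (conj z - conj a) * hAω'
  rw [norm_sq_mul_exp_neg_norm_sq, norm_sq_mul_exp_neg_norm_sq, harg, hexp, RCLike.norm_conj]
  exact (one_mul _).symm

theorem isNormalOperator_expWCO_of_fixed (hB : B = a * (1 - A)) (hD : D = conj a * (1 - A))
    (hC : C ≠ 0) : IsNormalOperator (expWCO A B C D) :=
  isNormalOperator_expWCO (isFormalAdjoint_expWCO_of_fixed hB hD hC)
    fun f => fockIntegral_expWCO_of_fixed hB hD f.differentiable.continuous

end FixedPoint

/-! ### Translations, the case `A = 1` -/

section Translation

variable {B C D : ℂ}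

/-- The translation by `B - conj D` matches the arguments of `f`, and `‖B‖ = ‖D‖` matches the
weights. -/
theorem fockIntegral_expWCO_translation (hBD : ‖B‖ = ‖D‖) {f : ℂ → ℂ} (hf : Continuous f) :
    fockIntegral (fun z => C * Complex.exp (D * z) * f (1 * z + B)) =
      fockIntegral (fun z => conj C * Complex.exp (conj B * z) * f (conj 1 * z + conj D)) := by
  rw [fockIntegral_eq_of_comp_isometry (f := fun z => C * Complex.exp (D * z) * f (1 * z + B))
    (g := fun z => conj C * Complex.exp (conj B * z) * f (conj 1 * z + conj D))
    (ω := 1) (b := B - conj D) (c := 1) (by fun_prop) norm_one zero_le_one, ENNReal.ofReal_one,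
    one_mul]
  intro z
  have harg : conj 1 * (1 * z + (B - conj D)) + conj D = 1 * z + B := by
    rw [map_one]; ring
  have hBD' : B * conj B = D * conj D := by
    rw [Complex.mul_conj', Complex.mul_conj', hBD]
  have hexp : 2 * (D * z).re - ‖z‖ ^ 2 =
      2 * (conj B * (1 * z + (B - conj D))).re - ‖1 * z + (B - conj D)‖ ^ 2 := by
    apply Complex.ofReal_injective
    rw [ofReal_two_re_sub_norm_sq, ofReal_two_re_sub_norm_sq]
    simp only [map_mul, Complex.conj_conj, map_sub, map_one, map_add]
    linear_combination -hBD'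
  rw [norm_sq_mul_exp_neg_norm_sq, norm_sq_mul_exp_neg_norm_sq, harg, hexp, RCLike.norm_conj]
  exact (one_mul _).symm

theorem mem_domain_expWCO_dilation {r : ℝ} (hr0 : 0 < r) (hr1 : r < 1) (f : FockSpace) :
    f ∈ (expWCO r (r * B) C D).domain := by
  have hδ : 0 < 1 - r ^ 2 := by nlinarith
  set m := ‖D‖ + r ^ 2 * ‖B‖ with hm
  refine mem_domain_expWCO_of_le (by exact_mod_cast hr0.ne')
    (K := m ^ 2 / (1 - r ^ 2) + r ^ 2 * ‖B‖ ^ 2) (fun z => ?_) f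
  have h1 : (D * z).re ≤ ‖D‖ * ‖z‖ := (Complex.re_le_norm _).trans (norm_mul_le _ _)
  have h2 : ‖(r : ℂ) * z + r * B‖ ^ 2 ≤ (r * (‖z‖ + ‖B‖)) ^ 2 := by
    gcongr
    rw [← mul_add, norm_mul, Complex.norm_real, Real.norm_of_nonneg hr0.le]
    gcongr
    exact norm_add_le _ _
  -- The maximum over `‖z‖` of a concave quadratic; `r < 1` is what makes it finite.
  have h3 : 2 * m * ‖z‖ - (1 - r ^ 2) * ‖z‖ ^ 2 ≤ m ^ 2 / (1 - r ^ 2) := by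
    rw [le_div_iff₀ hδ]
    nlinarith [sq_nonneg (m - (1 - r ^ 2) * ‖z‖)]
  have h4 : (r * (‖z‖ + ‖B‖)) ^ 2 = r ^ 2 * ‖z‖ ^ 2 + 2 * (r ^ 2 * ‖B‖) * ‖z‖ + r ^ 2 * ‖B‖ ^ 2 := by
    ring
  have h5 : 2 * m * ‖z‖ = 2 * (‖D‖ * ‖z‖) + 2 * (r ^ 2 * ‖B‖) * ‖z‖ := by rw [hm]; ring
  linarith

/-- The bound is uniform in `r`: with the triangle inequality, the excess is at most `1 - r` times
the left side of `h3`, itself bounded. -/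
theorem two_re_sub_norm_sq_le {r : ℝ} (hr0 : 0 ≤ r) (hr1 : r ≤ 1) (B D z : ℂ) :
    2 * (((1 - r : ℝ) * D) * z).re - ‖z‖ ^ 2 ≤
      (‖D‖ + ‖B‖) ^ 2 + ‖B‖ ^ 2 - ‖(r : ℂ) * z + (-(1 - r : ℝ) * B)‖ ^ 2 := by
  have h1 : (((1 - r : ℝ) * D) * z).re ≤ (1 - r) * (‖D‖ * ‖z‖) := by
    refine (Complex.re_le_norm _).trans ?_
    rw [norm_mul, norm_mul, Complex.norm_real, Real.norm_of_nonneg (by linarith), mul_assoc]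
  have h2 : ‖(r : ℂ) * z + (-(1 - r : ℝ) * B)‖ ^ 2 ≤ (r * ‖z‖ + (1 - r) * ‖B‖) ^ 2 := by
    gcongr
    refine (norm_add_le _ _).trans ?_
    rw [norm_mul, norm_mul, norm_neg, Complex.norm_real, Complex.norm_real,
      Real.norm_of_nonneg hr0, Real.norm_of_nonneg (by linarith)]
  have hs : 0 ≤ 1 - r := by linarith
  have hz := norm_nonneg z
  have hb := norm_nonneg B
  have hd := norm_nonneg D
  generalize ‖z‖ = t at *
  generalize ‖B‖ = b at *
  generalize ‖D‖ = d at *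
  have h3 : 2 * (d * t) + 2 * r * (t * b) + (1 - r) * b ^ 2 - (1 + r) * t ^ 2 ≤
      (d + b) ^ 2 + b ^ 2 := by
    nlinarith [sq_nonneg (d + b - t), mul_nonneg hr0 (sq_nonneg t), mul_nonneg hr0 (sq_nonneg b),
      mul_nonneg hs (mul_nonneg hz hb)]
  have h4 := mul_le_mul_of_nonneg_left h3 hs
  have h5 : (1 - r) * ((d + b) ^ 2 + b ^ 2) ≤ (d + b) ^ 2 + b ^ 2 := by
    have : 0 ≤ (d + b) ^ 2 + b ^ 2 := by positivity
    nlinarith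
  nlinarith

theorem isFormalAdjoint_expWCO_translation :
    (expWCO 1 B C D).IsFormalAdjoint (expWCO (conj 1) (conj D) (conj C) (conj B)) := by
  intro x y
  set h := expWCO 1 B C D x with hh
  set k := expWCO (conj 1) (conj D) (conj C) (conj B) y with hk
  -- The shift by `2` keeps `r n ≥ 1/2`, so the Jacobian factors `(r n)⁻²` are at most `4`.
  set r : ℕ → ℝ := fun n => 1 - 1 / ((n : ℝ) + 2) with hr
  have hr2 : ∀ n, 1 / 2 ≤ r n := fun n => by
    have : 1 / ((n : ℝ) + 2) ≤ 1 / 2 := by gcongr; linarith [n.cast_nonneg (α := ℝ)]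
    simp only [hr]
    linarith
  have hr0 : ∀ n, 0 < r n := fun n => lt_of_lt_of_le (by norm_num) (hr2 n)
  have hr1 : ∀ n, r n < 1 := fun n => by
    have : 0 < 1 / ((n : ℝ) + 2) := by positivity
    simp only [hr]
    linarith
  have hrc : ∀ n, (r n : ℂ) ≠ 0 := fun n => by exact_mod_cast (hr0 n).ne'
  have hrlim : Tendsto (fun n => (r n : ℂ)) atTop (𝓝 1) := by
    have h1 : Tendsto (fun n : ℕ => 1 / ((n : ℝ) + 2)) atTop (𝓝 0) :=
      tendsto_const_nhds.div_atTop (tendsto_atTop_add_const_right _ _ tendsto_natCast_atTop_atTop)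
    have h2 : Tendsto r atTop (𝓝 (1 - 0)) := tendsto_const_nhds.sub h1
    rw [sub_zero] at h2
    exact_mod_cast (Complex.continuous_ofReal.tendsto 1).comp h2
  have hrinv : ∀ n, (‖(r n : ℂ)‖ ^ 2)⁻¹ ≤ 4 := fun n => by
    rw [Complex.norm_real, Real.norm_of_nonneg (hr0 n).le, inv_le_comm₀ (pow_pos (hr0 n) 2)
      (by norm_num)]
    nlinarith [hr2 n]
  have hdom : ∀ n (f : FockSpace), f ∈ (expWCO (r n) (r n * B) C D).domain := fun n f =>
    mem_domain_expWCO_dilation (hr0 n) (hr1 n) f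
  let u : ℕ → FockSpace := fun n => expWCO (r n) (r n * B) C D ⟨x, hdom n x⟩
  have hPdom : ∀ n, k ∈ (expWCO (r n) 0 1 0).domain := fun n =>
    mem_domain_expWCO_of_fixed (a := 0)
      (by rw [Complex.norm_real, Real.norm_of_nonneg (hr0 n).le]; exact (hr1 n).le)
      (by simp) (by simp) k
  let v : ℕ → FockSpace := fun n => expWCO (r n) 0 1 0 ⟨k, hPdom n⟩
  have hvz : ∀ n z, v n z = k (r n * z) := fun n z => by
    simp [v]
  -- The adjoint of the dilated operator sends `y` to the dilate `k (r z)`, whose norm is controlled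
  -- by that of `k`.
  have hv' : ∀ n, (fun z => conj C * Complex.exp (conj ((r n : ℂ) * B) * z) *
      (y : FockSpace) (conj (r n : ℂ) * z + conj D)) = v n := by
    intro n
    funext z
    rw [hvz, hk, maximalWCO_apply]
    simp only [map_mul, Complex.conj_ofReal, map_one, one_mul]
    congr 3
    ring
  have huv : ∀ n, inner ℂ (u n) (y : FockSpace) = inner ℂ (x : FockSpace) (v n) := by
    intro n
    have hy : (y : FockSpace) ∈
        (expWCO (conj (r n : ℂ)) (conj D) (conj C) (conj ((r n : ℂ) * B))).domain := by
      rw [mem_domain_maximalWCO, hv' n]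
      exact Subtype.prop _
    refine (isFormalAdjoint_of_forall_mem (hdom n) ⟨x, hdom n x⟩ ⟨y, hy⟩).trans ?_
    congr 1
    exact FockSpace.ext fun z => congrFun (hv' n) z
  set K := (‖D‖ + ‖B‖) ^ 2 + ‖B‖ ^ 2 with hK
  have huM : ∀ n, ‖u n‖ ≤
      Real.sqrt (Real.exp (2 * (‖D‖ * ‖B‖)) * Real.exp K * 4) * ‖h‖ := by
    intro n
    have hs0 : 0 ≤ 1 - r n := by linarith [hr1 n]
    have hle : ‖Complex.exp ((1 - r n : ℝ) * D * B)‖ ^ 2 * Real.exp K * (‖(r n : ℂ)‖ ^ 2)⁻¹ ≤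
        Real.exp (2 * (‖D‖ * ‖B‖)) * Real.exp K * 4 := by
      gcongr
      · rw [Complex.norm_exp, ← Real.exp_nat_mul]
        refine Real.exp_le_exp.2 ?_
        have h1 : (((1 - r n : ℝ) : ℂ) * D * B).re ≤ (1 - r n) * (‖D‖ * ‖B‖) := by
          refine (Complex.re_le_norm _).trans ?_
          rw [norm_mul, norm_mul, Complex.norm_real, Real.norm_of_nonneg hs0, mul_assoc]
        have h2 : (1 - r n) * (‖D‖ * ‖B‖) ≤ ‖D‖ * ‖B‖ :=
          mul_le_of_le_one_left (by positivity) (by linarith [hr0 n])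
        push_cast at h1 ⊢
        linarith
      · exact hrinv n
    refine norm_le_of_fockIntegral_le (by positivity) ((fockIntegral_le_of_comp_affine
      h.differentiable.continuous (hrc n) (b := -(1 - r n : ℝ) * B)
      (c := ‖Complex.exp ((1 - r n : ℝ) * D * B)‖ ^ 2 * Real.exp K)
      (by positivity) fun z => ?_).trans (mul_le_mul_left (ENNReal.ofReal_le_ofReal hle) _))
    -- Expressing `u n` through `h = T x` rather than `x` makes its bound independent of `n`.
    have huz : u n z = Complex.exp ((1 - r n : ℝ) * D * B) *
        Complex.exp (((1 - r n : ℝ) * D) * z) * h (r n * z + -(1 - r n : ℝ) * B) := by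
      rw [hh, maximalWCO_apply]
      simp only [maximalWCO_apply]
      have h1 : 1 * ((r n : ℂ) * z + -(1 - r n : ℝ) * B) + B = r n * z + r n * B := by
        push_cast; ring
      have h2 : Complex.exp (D * z) = Complex.exp ((1 - r n : ℝ) * D * B) *
        Complex.exp (((1 - r n : ℝ) * D) * z) *
          Complex.exp (D * (r n * z + -(1 - r n : ℝ) * B)) := by
        rw [← Complex.exp_add, ← Complex.exp_add]
        congr 1
        push_cast
        ring
      rw [h1, h2]
      ring
    rw [huz]
    exact norm_sq_mul_exp_le (two_re_sub_norm_sq_le (hr0 n).le (hr1 n).le B D z)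
  have hvM : ∀ n, ‖v n‖ ≤ Real.sqrt 4 * ‖k‖ := by
    intro n
    have hle : 1 * (‖(r n : ℂ)‖ ^ 2)⁻¹ ≤ 4 := by rw [one_mul]; exact hrinv n
    refine norm_le_of_fockIntegral_le (by positivity) ((fockIntegral_le_of_comp_affine
      k.differentiable.continuous (hrc n) (b := 0) (c := 1) zero_le_one fun z => ?_).trans
        (mul_le_mul_left (ENNReal.ofReal_le_ofReal hle) _))
    rw [hvz, add_zero, one_mul]
    gcongr
    rw [norm_mul, Complex.norm_real, Real.norm_of_nonneg (hr0 n).le]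
    exact mul_le_of_le_one_left (norm_nonneg _) (hr1 n).le
  have hlimu : ∀ z, Tendsto (fun n => u n z) atTop (𝓝 (h z)) := by
    intro z
    rw [hh, maximalWCO_apply]
    refine Tendsto.const_mul _ (((x : FockSpace).differentiable.continuous.tendsto _).comp ?_)
    simpa using (hrlim.mul_const z).add (hrlim.mul_const B)
  have hlimv : ∀ z, Tendsto (fun n => v n z) atTop (𝓝 (k z)) := by
    intro z
    simp only [hvz]
    refine (k.differentiable.continuous.tendsto _).comp ?_
    simpa using hrlim.mul_const z
  -- Both sequences are bounded and converge pointwise, hence weakly, so `huv` passes to the limit.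
  have h1 := tendsto_inner_of_tendsto_apply huM hlimu y
  have h2 := tendsto_inner_of_tendsto_apply hvM hlimv x
  have h3 := (Complex.continuous_conj.tendsto _).comp h2
  simp only [Function.comp_def, inner_conj_symm] at h3
  simp only [huv] at h1
  exact tendsto_nhds_unique h1 h3

theorem isNormalOperator_expWCO_translation (hBD : ‖B‖ = ‖D‖) :
    IsNormalOperator (expWCO 1 B C D) :=
  isNormalOperator_expWCO isFormalAdjoint_expWCO_translation
    fun f => fockIntegral_expWCO_translation hBD f.differentiable.continuous

end Translation

/-! ### Entire functions of quadratic growth -/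

section EntireFunctions

theorem exists_eq_exp_of_differentiable {f : ℂ → ℂ} (hf : Differentiable ℂ f) (h0 : ∀ z, f z ≠ 0) :
    ∃ q : ℂ → ℂ, Differentiable ℂ q ∧ ∀ z, f z = Complex.exp (q z) := by
  have hd : Differentiable ℂ fun z => deriv f z / f z := hf.deriv.div hf h0
  obtain ⟨q, hq⟩ := hd.isExactOn_univ
  have hq' : ∀ z, HasDerivAt q (deriv f z / f z) z := fun z => hq z (Set.mem_univ z)
  have hder : ∀ z, HasDerivAt (fun z => f z * Complex.exp (-q z)) 0 z := by
    intro z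
    refine ((hf z).hasDerivAt.mul (hq' z).neg.cexp).congr_deriv ?_
    have := h0 z
    field_simp
    ring
  have hconst : ∀ z, f z * Complex.exp (-q z) = f 0 * Complex.exp (-q 0) := fun z =>
    is_const_of_deriv_eq_zero (fun z => (hder z).differentiableAt) (fun z => (hder z).deriv) z 0
  have hne : f 0 * Complex.exp (-q 0) ≠ 0 := mul_ne_zero (h0 0) (Complex.exp_ne_zero _)
  refine ⟨fun z => Complex.log (f 0 * Complex.exp (-q 0)) + q z,
    (fun z => (hq' z).differentiableAt.const_add _), fun z => ?_⟩
  rw [Complex.exp_add, Complex.exp_log hne, ← hconst z, mul_assoc, ← Complex.exp_add,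
    neg_add_cancel, Complex.exp_zero, mul_one]

theorem norm_le_of_re_le {h : ℂ → ℂ} (hd : Differentiable ℂ h) {c : ℝ}
    (hre : ∀ z, (h z).re ≤ ‖z‖ ^ 2 / 2 + c) (z : ℂ) :
    ‖h z‖ ≤ 2 * (|c| + 1 + 2 * (‖z‖ + 1) ^ 2) + 3 * ‖h 0‖ := by
  have hz := norm_nonneg z
  have hM : 0 < |c| + 1 + 2 * (‖z‖ + 1) ^ 2 := by positivity
  -- With `R = 2 (‖z‖ + 1)`, `R ^ 2 / 2` is the quadratic term of the bound, and the two quotients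
  -- are at most `2` and `3`.
  have h1 := Complex.borelCaratheodory (f := h) (R := 2 * (‖z‖ + 1)) (z := z) hM
    hd.differentiableOn (fun x hx => by
      rw [Metric.mem_ball, dist_zero_right] at hx
      have h2 : ‖x‖ ^ 2 ≤ (2 * (‖z‖ + 1)) ^ 2 := by gcongr
      have h3 := hre x
      have h4 := le_abs_self c
      simp only [Set.mem_ofPred_eq]
      nlinarith) (by positivity) (by rw [Metric.mem_ball, dist_zero_right]; linarith)
  have hpos : 0 < 2 * (‖z‖ + 1) - ‖z‖ := by linarith
  refine h1.trans (add_le_add ?_ ?_)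
  · rw [div_le_iff₀ hpos]
    nlinarith
  · rw [div_le_iff₀ hpos]
    nlinarith [norm_nonneg (h 0)]

theorem iteratedDeriv_three_eq_zero {h : ℂ → ℂ} (hd : Differentiable ℂ h) {c : ℝ}
    (hre : ∀ z, (h z).re ≤ ‖z‖ ^ 2 / 2 + c) (z : ℂ) : iteratedDeriv 3 h z = 0 := by
  set K := 2 * |c| + 18 + 3 * ‖h 0‖ with hK
  have hbound : ∀ R : ℝ, ‖z‖ + 1 ≤ R → ‖iteratedDeriv 3 h z‖ ≤ 6 * K / R := by
    intro R hR
    have hR1 : 1 ≤ R := by linarith [norm_nonneg z]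
    have hR0 : 0 < R := by linarith
    -- Cauchy's estimate: growth `K * R ^ 2` against `R ^ 3`. On the sphere `‖x‖ + 1 ≤ 2 * R`,
    -- whence `18 = 2 + 16` in `K`.
    have h1 := Complex.norm_iteratedDeriv_le_of_forall_mem_sphere_norm_le (c := z) (C := K * R ^ 2)
      3 hR0 hd.diffContOnCl fun x hx => by
        have hx' : ‖x‖ ≤ ‖z‖ + R := by
          rw [mem_sphere_iff_norm] at hx
          calc ‖x‖ = ‖z + (x - z)‖ := by rw [add_sub_cancel]
            _ ≤ ‖z‖ + R := (norm_add_le _ _).trans (by rw [hx])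
        have h2 := norm_le_of_re_le hd hre x
        have h3 : (‖x‖ + 1) ^ 2 ≤ (2 * R) ^ 2 := by gcongr; linarith
        have h4 : 1 ≤ R ^ 2 := one_le_pow₀ hR1
        rw [hK]
        nlinarith [abs_nonneg c, norm_nonneg (h 0)]
    refine h1.trans (le_of_eq ?_)
    have : ((Nat.factorial 3 : ℕ) : ℝ) = 6 := by norm_num [Nat.factorial]
    rw [this]
    field_simp
  have hlim : Tendsto (fun R : ℝ => 6 * K / R) atTop (𝓝 0) :=
    tendsto_const_nhds.div_atTop tendsto_id
  have h0 := ge_of_tendsto hlim ((eventually_ge_atTop (‖z‖ + 1)).mono hbound)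
  exact norm_le_zero_iff.1 h0

/-- An entire function whose real part grows at most quadratically is a quadratic polynomial. -/
theorem exists_quadratic_of_re_le {h : ℂ → ℂ} (hd : Differentiable ℂ h) {c : ℝ}
    (hre : ∀ z, (h z).re ≤ ‖z‖ ^ 2 / 2 + c) :
    ∃ α β γ : ℂ, ∀ z, h z = α * z ^ 2 + β * z + γ := by
  have h3 : ∀ z, deriv (deriv (deriv h)) z = 0 := fun z => by
    have := iteratedDeriv_three_eq_zero hd hre z
    simpa [iteratedDeriv_succ, iteratedDeriv_zero] using this
  have hd1 : Differentiable ℂ (deriv h) := hd.deriv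
  have hd2 : Differentiable ℂ (deriv (deriv h)) := hd1.deriv
  have e2 : ∀ z, deriv (deriv h) z = deriv (deriv h) 0 := fun z =>
    is_const_of_deriv_eq_zero hd2 h3 z 0
  set a := deriv (deriv h) 0
  have g1 : ∀ z, HasDerivAt (fun z => deriv h z - a * z) 0 z := fun z => by
    refine ((hd1 z).hasDerivAt.sub ((hasDerivAt_id z).const_mul a)).congr_deriv ?_
    rw [e2 z, mul_one, sub_self]
  have e1 : ∀ z, deriv h z - a * z = deriv h 0 - a * 0 := fun z =>
    is_const_of_deriv_eq_zero (fun z => (g1 z).differentiableAt) (fun z => (g1 z).deriv) z 0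
  have g0 : ∀ z, HasDerivAt (fun z => h z - (a / 2 * z ^ 2 + deriv h 0 * z)) 0 z := fun z => by
    refine ((hd z).hasDerivAt.sub (((hasDerivAt_pow 2 z).const_mul (a / 2)).add
      ((hasDerivAt_id z).const_mul (deriv h 0)))).congr_deriv ?_
    push_cast
    linear_combination e1 z
  have e0 : ∀ z, h z - (a / 2 * z ^ 2 + deriv h 0 * z) =
      h 0 - (a / 2 * 0 ^ 2 + deriv h 0 * 0) := fun z =>
    is_const_of_deriv_eq_zero (fun z => (g0 z).differentiableAt) (fun z => (g0 z).deriv) z 0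
  exact ⟨a / 2, deriv h 0, h 0, fun z => by linear_combination e0 z⟩

theorem leadingCoeff_eq_zero_of_re_le {α β γ p d e : ℂ}
    (h : ∀ w : ℂ, ∃ c : ℝ, ∀ z : ℂ, ((p * z ^ 2 + d * z + e) +
      conj w * (α * z ^ 2 + β * z + γ)).re ≤ ‖z‖ ^ 2 / 2 + c) : α = 0 := by
  by_contra hα
  have hα0 : 0 < ‖α‖ ^ 2 := by have := norm_pos_iff.2 hα; positivity
  -- With `w = s * α`, the coefficient of `t ^ 2` on the real axis has real part at least `1`,
  -- exceeding the allowed `1/2`.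
  set s : ℝ := (1 + ‖p‖) / ‖α‖ ^ 2 with hs
  obtain ⟨c, hc⟩ := h (s * α)
  set L : ℝ := (d + s * conj α * β).re with hL
  set N : ℝ := (e + s * conj α * γ).re with hN
  have hsα : s * ‖α‖ ^ 2 = 1 + ‖p‖ := div_mul_cancel₀ _ hα0.ne'
  have key : ∀ t : ℝ, (p.re + (1 + ‖p‖)) * t ^ 2 + L * t + N ≤ t ^ 2 / 2 + c := by
    intro t
    have h1 := hc t
    have h2 : (p * (t : ℂ) ^ 2 + d * t + e) +
        conj ((s : ℂ) * α) * (α * (t : ℂ) ^ 2 + β * t + γ) =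
        (p + ((s * ‖α‖ ^ 2 : ℝ) : ℂ)) * ((t ^ 2 : ℝ) : ℂ) + (d + s * conj α * β) * (t : ℂ) +
          (e + s * conj α * γ) := by
      have := Complex.conj_mul' α
      rw [map_mul, Complex.conj_ofReal]
      push_cast
      linear_combination (s * (t : ℂ) ^ 2) * this
    rw [h2, hsα, Complex.add_re, Complex.add_re, Complex.re_mul_ofReal, Complex.re_mul_ofReal,
      Complex.add_re, Complex.ofReal_re, Complex.norm_real, Real.norm_eq_abs, sq_abs] at h1
    exact h1
  have hp : -‖p‖ ≤ p.re := (abs_le.1 (Complex.abs_re_le_norm p)).1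
  have h1 := key (2 * (|L| + |N - c| + 1))
  set t := 2 * (|L| + |N - c| + 1) with ht
  have ht1 : 1 ≤ t := by linarith [abs_nonneg L, abs_nonneg (N - c)]
  have h2 : -|L| * t ≤ L * t := mul_le_mul_of_nonneg_right (neg_abs_le L) (by linarith)
  have h3 := neg_abs_le (N - c)
  have h4 : 1 * t ^ 2 ≤ (p.re + (1 + ‖p‖)) * t ^ 2 :=
    mul_le_mul_of_nonneg_right (by linarith) (sq_nonneg t)
  have h5 : t ^ 2 / 2 = |L| * t + |N - c| * t + t := by rw [sq]; nth_rewrite 1 [ht]; ring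
  have h6 : |N - c| ≤ |N - c| * t := le_mul_of_one_le_right (abs_nonneg _) ht1
  linarith

end EntireFunctions

/-! ### Gaussian integral identities for the coefficients -/

section GaussianIntegrals

theorem eq_zero_of_forall_re_mul_eq_zero {Y : ℂ} (h : ∀ w : ℂ, (w * Y).re = 0) : Y = 0 := by
  have h1 := h (conj Y)
  rw [Complex.conj_mul', ← Complex.ofReal_pow, Complex.ofReal_re] at h1
  exact norm_eq_zero.1 (pow_eq_zero_iff two_ne_zero |>.1 h1)

/-- Translation law of the Gaussian integrals `∫ |exp(p z² + u z)|² exp(-|z|²)`. -/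
theorem fockIntegral_exp_quadratic_translate (p u s : ℂ) :
    fockIntegral (fun z => Complex.exp (p * z ^ 2 + u * z)) =
      ENNReal.ofReal (Real.exp (2 * (p * s ^ 2 + u * s).re - ‖s‖ ^ 2)) *
        fockIntegral (fun z => Complex.exp (p * z ^ 2 + (u + (2 * p * s - conj s)) * z)) := by
  refine fockIntegral_eq_of_comp_isometry (ω := 1) (b := -s) (by fun_prop) norm_one
    (by positivity) fun z => ?_
  rw [Complex.norm_exp, Complex.norm_exp, ← Real.exp_nat_mul, ← Real.exp_nat_mul, ← Real.exp_add,
    ← Real.exp_add, ← Real.exp_add]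
  congr 1
  simp only [← Complex.normSq_eq_norm_sq, Complex.normSq_apply]
  simp only [Complex.add_re, Complex.add_im, Complex.sub_re, Complex.sub_im, Complex.neg_re,
    Complex.neg_im, Complex.mul_re, Complex.mul_im, Complex.conj_re, Complex.conj_im, Complex.one_re,
    Complex.one_im, sq, Complex.re_ofNat,
    Complex.im_ofNat]
  push_cast
  ring

theorem fockIntegral_exp_linear (u : ℂ) :
    fockIntegral (fun z => Complex.exp (u * z)) = ENNReal.ofReal (Real.exp (‖u‖ ^ 2)) := by
  have h := FockSpace.enorm_sq_eq_fockIntegral (kern (conj u))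
  rw [← ofReal_norm, ← ENNReal.ofReal_pow (norm_nonneg _), norm_kern_sq, RCLike.norm_conj] at h
  have hk : (fun z => Complex.exp (u * z)) = kern (conj u) := by
    funext z
    rw [kern_apply, Complex.conj_conj]
  rw [hk, h]

variable {p d e A B : ℂ}

theorem fockIntegral_exp_quadratic_eq
    (h : ∀ w : ℂ, fockIntegral
      (fun z => Complex.exp (p * z ^ 2 + d * z + e) * Complex.exp (conj w * (A * z + B))) =
      ENNReal.ofReal (‖Complex.exp (p * w ^ 2 + d * w + e)‖ ^ 2 * Real.exp (‖A * w + B‖ ^ 2)))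
    (w : ℂ) : fockIntegral (fun z => Complex.exp (p * z ^ 2 + (d + conj w * A) * z)) =
      ENNReal.ofReal (Real.exp (2 * (p * w ^ 2 + d * w - conj w * B).re + ‖A * w + B‖ ^ 2)) := by
  have h1 : (fun z => Complex.exp (p * z ^ 2 + (d + conj w * A) * z)) =
      fun z => Complex.exp (-(e + conj w * B)) *
        (Complex.exp (p * z ^ 2 + d * z + e) * Complex.exp (conj w * (A * z + B))) := by
    funext z
    rw [← Complex.exp_add, ← Complex.exp_add]
    congr 1
    ring
  rw [h1, fockIntegral_const_mul, h w, ← ENNReal.ofReal_mul (by positivity), Complex.norm_exp,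
    Complex.norm_exp, ← Real.exp_nat_mul, ← Real.exp_nat_mul, ← Real.exp_add, ← Real.exp_add]
  congr 2
  simp only [Complex.add_re, Complex.sub_re, Complex.neg_re]
  push_cast
  ring

/-- No closed form of the integral is needed. If `A ≠ 0`, the hypothesis gives its value for every
linear coefficient `u = d + conj w * A`, and the translation law relates the values at `u` and `u +
(2 p s - conj s)`. Comparing the parts linear in `w` gives an identity in `s` and `conj s` where `s`
has coefficient `4 |p|²`. -/
theorem quadraticCoeff_eq_zero
    (h : ∀ w : ℂ, fockIntegral (fun z => Complex.exp (p * z ^ 2 + (d + conj w * A) * z)) =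
      ENNReal.ofReal (Real.exp (2 * (p * w ^ 2 + d * w - conj w * B).re + ‖A * w + B‖ ^ 2))) :
    p = 0 := by
  have hinj : ∀ {x y : ℝ}, ENNReal.ofReal (Real.exp x) = ENNReal.ofReal (Real.exp y) → x = y :=
    fun {x y} hxy => Real.exp_injective
      ((ENNReal.ofReal_eq_ofReal_iff (by positivity) (by positivity)).1 hxy)
  rcases eq_or_ne A 0 with rfl | hA
  -- For `A = 0` the integral does not depend on `w`.
  · have h1 : ∀ w : ℂ, (p * w ^ 2 + d * w - conj w * B).re = 0 := fun w => by
      have h2 := h w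
      rw [mul_zero, ← mul_zero (conj (0 : ℂ)), h 0] at h2
      have h3 := hinj h2
      simp only [zero_mul, map_zero, mul_zero, ne_eq, OfNat.ofNat_ne_zero, not_false_eq_true,
        zero_pow, add_zero, sub_zero, Complex.zero_re] at h3
      linarith
    have a1 := h1 1
    have a2 := h1 (-1)
    have a3 := h1 (1 + Complex.I)
    have a4 := h1 (-(1 + Complex.I))
    simp [sq] at a1 a2 a3 a4
    exact Complex.ext (by simp; linarith) (by simp; linarith)
  · have key : ∀ s : ℂ, 2 * conj p * (2 * p * s - conj s) + 2 * A ^ 2 * conj p * conj s = 0 := by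
      intro s
      -- Moving `w` by `t` shifts the linear coefficient by `2 p s - conj s`.
      set t := conj ((2 * p * s - conj s) / A) with ht
      have htA : conj t * A = 2 * p * s - conj s := by
        rw [ht, Complex.conj_conj, div_mul_cancel₀ _ hA]
      have htA' : t * conj A = 2 * conj p * conj s - s := by
        have := congrArg conj htA
        simpa only [map_mul, map_sub, Complex.conj_conj, map_ofNat] using this
      have hQ : ∀ w : ℂ, 2 * (p * w ^ 2 + d * w - conj w * B).re + ‖A * w + B‖ ^ 2 =
          2 * (p * s ^ 2 + (d + conj w * A) * s).re - ‖s‖ ^ 2 +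
          (2 * (p * (w + t) ^ 2 + d * (w + t) - conj (w + t) * B).re +
            ‖A * (w + t) + B‖ ^ 2) := by
        intro w
        have h1 := fockIntegral_exp_quadratic_translate p (d + conj w * A) s
        have h2 : d + conj w * A + (2 * p * s - conj s) = d + conj (w + t) * A := by
          rw [map_add]; linear_combination -htA
        rw [h2, h w, h (w + t), ← ENNReal.ofReal_mul (by positivity), ← Real.exp_add] at h1
        exact hinj h1
      have hX : ∀ w : ℂ, (w * (2 * p * t + A * conj A * conj t + conj A * conj s)).re = 0 := by
        intro w
        have h1 := hQ w
        have h2 := hQ 0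
        simp only [← Complex.normSq_eq_norm_sq, Complex.normSq_apply] at h1 h2
        simp only [Complex.add_re, Complex.add_im, Complex.sub_re, Complex.mul_re, Complex.mul_im,
          Complex.conj_re, Complex.conj_im, sq, Complex.re_ofNat, Complex.im_ofNat,
          Complex.zero_re, Complex.zero_im] at h1 h2 ⊢
        linear_combination (h2 - h1) / 2
      have h3 := congrArg conj (eq_zero_of_forall_re_mul_eq_zero hX)
      simp only [map_add, map_mul, Complex.conj_conj, map_zero, map_ofNat] at h3
      linear_combination A * h3 - 2 * conj p * htA - A ^ 2 * htA'
    have k1 := key 1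
    have k2 := key Complex.I
    simp only [map_one, Complex.conj_I] at k1 k2
    -- The combination of `s = 1` and `s = I` isolates the coefficient of `s`.
    have h8 : conj p * p = 0 := by
      linear_combination (1 / 8) * k1 - (Complex.I / 8) * k2 +
        ((2 * conj p * (2 * p + 1) - 2 * A ^ 2 * conj p) / 8) * Complex.I_mul_I
    simpa using h8

/-- The integral is now `exp (‖d + conj w * A‖ ^ 2)`; the two relations are the constant and linear
parts in `w` of the equality of exponents. -/
theorem linearCoeff_relations
    (h : ∀ w : ℂ, fockIntegral (fun z => Complex.exp ((d + conj w * A) * z)) =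
      ENNReal.ofReal (Real.exp (2 * (d * w - conj w * B).re + ‖A * w + B‖ ^ 2))) :
    ‖B‖ = ‖d‖ ∧ d * (1 - conj A) = conj B * (1 - A) := by
  have hQ : ∀ w : ℂ, ‖d + conj w * A‖ ^ 2 =
      2 * (d * w - conj w * B).re + ‖A * w + B‖ ^ 2 := fun w => by
    have h1 := h w
    rw [fockIntegral_exp_linear] at h1
    exact Real.exp_injective
      ((ENNReal.ofReal_eq_ofReal_iff (by positivity) (by positivity)).1 h1)
  have h0 := hQ 0
  simp only [map_zero, zero_mul, mul_zero, add_zero, zero_add, sub_zero, Complex.zero_re] at h0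
  refine ⟨((sq_eq_sq₀ (norm_nonneg _) (norm_nonneg _)).1 h0).symm, ?_⟩
  have hY : ∀ w : ℂ, (w * (d * (1 - conj A) - conj B * (1 - A))).re = 0 := by
    intro w
    have h1 := hQ w
    simp only [← Complex.normSq_eq_norm_sq, Complex.normSq_apply, Complex.add_re,
      Complex.add_im, Complex.sub_re, Complex.sub_im, Complex.mul_re, Complex.mul_im,
      Complex.conj_re, Complex.conj_im, Complex.one_re, Complex.one_im] at h0 h1 ⊢
    linear_combination (h0 - h1) / 2
  exact sub_eq_zero.1 (eq_zero_of_forall_re_mul_eq_zero hY)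

end GaussianIntegrals

/-! ### Consequences of normality -/

section Normal

variable {ψ φ : ℂ → ℂ}

theorem inner_smul_kern_eq_inner_maximalWCO (w : ℂ) (x : (maximalWCO ψ φ).domain) :
    inner ℂ (conj (ψ w) • kern (φ w)) (x : FockSpace) = inner ℂ (kern w) (maximalWCO ψ φ x) := by
  rw [inner_smul_left, inner_kern, inner_kern, Complex.conj_conj, maximalWCO_apply]

theorem kern_mem_adjoint_domain (w : ℂ) : kern w ∈ (maximalWCO ψ φ).adjoint.domain :=
  LinearPMap.mem_adjoint_domain_of_exists _ ⟨_, inner_smul_kern_eq_inner_maximalWCO w⟩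

theorem IsNormalOperator.kern_mem_domain (hN : IsNormalOperator (maximalWCO ψ φ)) (w : ℂ) :
    kern w ∈ (maximalWCO ψ φ).domain := by
  rw [hN.2.2.1]
  exact kern_mem_adjoint_domain w

theorem IsNormalOperator.norm_maximalWCO_kern (hN : IsNormalOperator (maximalWCO ψ φ)) (w : ℂ) :
    ‖maximalWCO ψ φ ⟨kern w, hN.kern_mem_domain w⟩‖ = ‖ψ w‖ * ‖kern (φ w)‖ := by
  rw [hN.2.2.2 _ (hN.kern_mem_domain w) (kern_mem_adjoint_domain w),
    LinearPMap.adjoint_apply_eq hN.2.1 ⟨kern w, kern_mem_adjoint_domain w⟩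
      (inner_smul_kern_eq_inner_maximalWCO w), norm_smul, RCLike.norm_conj]

theorem IsNormalOperator.fockIntegral_mul_exp (hN : IsNormalOperator (maximalWCO ψ φ)) (w : ℂ) :
    fockIntegral (fun z => ψ z * Complex.exp (conj w * φ z)) =
      ENNReal.ofReal (‖ψ w‖ ^ 2 * Real.exp (‖φ w‖ ^ 2)) := by
  have h := FockSpace.enorm_sq_eq_fockIntegral
    (maximalWCO ψ φ ⟨kern w, hN.kern_mem_domain w⟩)
  rw [← ofReal_norm, ← ENNReal.ofReal_pow (norm_nonneg _), hN.norm_maximalWCO_kern, mul_pow,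
    norm_kern_sq] at h
  rw [h]
  rfl

/-- At a zero `w` of `ψ`, `T* K_w = 0`, hence `T K_w = 0`; as `K_w ∘ φ` has no zeros, `ψ` would
vanish identically. -/
theorem IsNormalOperator.weight_ne_zero (hN : IsNormalOperator (maximalWCO ψ φ))
    (hψ0 : ∃ z, ψ z ≠ 0) (w : ℂ) : ψ w ≠ 0 := by
  intro hw
  have h := hN.norm_maximalWCO_kern w
  rw [hw, norm_zero, zero_mul, norm_eq_zero] at h
  obtain ⟨z, hz⟩ := hψ0
  have h1 := maximalWCO_apply ⟨kern w, hN.kern_mem_domain w⟩ z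
  rw [h, FockSpace.zero_apply, kern_apply] at h1
  exact mul_ne_zero hz (Complex.exp_ne_zero _) h1.symm

theorem IsNormalOperator.exists_affine (hN : IsNormalOperator (maximalWCO ψ φ))
    (hψ : Differentiable ℂ ψ) (hφ : Differentiable ℂ φ) (hψ0 : ∃ z, ψ z ≠ 0) :
    ∃ A B C D : ℂ, (∀ z, φ z = A * z + B) ∧ (∀ z, ψ z = C * Complex.exp (D * z)) ∧
      ‖B‖ = ‖D‖ ∧ D * (1 - conj A) = conj B * (1 - A) := by
  obtain ⟨q, hq, hψq⟩ := exists_eq_exp_of_differentiable hψ (hN.weight_ne_zero hψ0)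
  have hgrowth : ∀ w : ℂ, ∃ c : ℝ, ∀ z, (q z + conj w * φ z).re ≤ ‖z‖ ^ 2 / 2 + c := by
    intro w
    set F := maximalWCO ψ φ ⟨kern w, hN.kern_mem_domain w⟩ with hF
    refine ⟨‖F‖, fun z => ?_⟩
    have h1 := FockSpace.norm_apply_le F z
    rw [hF, maximalWCO_apply, ← hF, kern_apply, hψq, ← Complex.exp_add, Complex.norm_exp] at h1
    -- Taking `c = ‖F‖` instead of `log ‖F‖` avoids any discussion of `F = 0`.
    have h2 : ‖F‖ ≤ Real.exp ‖F‖ := by linarith [Real.add_one_le_exp ‖F‖]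
    rw [← Real.exp_le_exp, Real.exp_add]
    exact h1.trans (mul_le_mul_of_nonneg_left h2 (Real.exp_pos _).le)
  -- The values `w = 0` and `w = 1` make `q` and `q + φ` quadratic, hence `φ`.
  obtain ⟨c0, hc0⟩ := hgrowth 0
  obtain ⟨c1, hc1⟩ := hgrowth 1
  simp only [map_zero, zero_mul, add_zero] at hc0
  simp only [map_one, one_mul] at hc1
  obtain ⟨p, d, e, hpq⟩ := exists_quadratic_of_re_le hq hc0
  obtain ⟨α, β, γ, hαβ⟩ := exists_quadratic_of_re_le (hq.add hφ) hc1
  have hφ2 : ∀ z, φ z = (α - p) * z ^ 2 + (β - d) * z + (γ - e) := fun z => by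
    have := hαβ z
    rw [Pi.add_apply, hpq] at this
    linear_combination this
  have hα : α - p = 0 := leadingCoeff_eq_zero_of_re_le (β := β - d) (γ := γ - e) (p := p) (d := d)
    (e := e) fun w => by
      obtain ⟨c, hc⟩ := hgrowth w
      exact ⟨c, fun z => by rw [← hpq, ← hφ2]; exact hc z⟩
  generalize β - d = A at *
  generalize γ - e = B at *
  have hφ1 : ∀ z, φ z = A * z + B := fun z => by rw [hφ2, hα, zero_mul, zero_add]
  have hI := hN.fockIntegral_mul_exp
  simp only [hψq, hpq, hφ1] at hI
  have hI2 := fockIntegral_exp_quadratic_eq hI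
  obtain rfl := quadraticCoeff_eq_zero hI2
  simp only [zero_mul, zero_add] at hI2
  refine ⟨A, B, Complex.exp e, d, hφ1, fun z => ?_, linearCoeff_relations hI2⟩
  rw [hψq, hpq, ← Complex.exp_add]
  congr 1
  ring

end Normal

end Fock

/-! ### The equivalence -/

theorem theorem6p3 (ψ φ : ℂ → ℂ) (hψ : Differentiable ℂ ψ) (hφ : Differentiable ℂ φ)
    (hψ0 : ∃ z, ψ z ≠ 0) :
    Fock.IsNormalOperator (Fock.maximalWCO ψ φ) ↔
      ((∃ A B C D : ℂ, A ≠ 1 ∧ (∀ z, φ z = A * z + B) ∧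
          (∀ z, ψ z = C * Complex.exp (D * z)) ∧
          D = conj B * (1 - A) * (1 - conj A)⁻¹) ∨
        (∃ B C D : ℂ, (∀ z, φ z = z + B) ∧
          (∀ z, ψ z = C * Complex.exp (D * z)) ∧ ‖B‖ = ‖D‖)) := by
  have hconj : ∀ {A : ℂ}, A ≠ 1 → 1 - conj A ≠ 0 := fun {A} hA => by
    have h : conj (1 - A) ≠ 0 := (map_ne_zero _).2 (sub_ne_zero.2 hA.symm)
    rwa [map_sub, map_one] at h
  constructor
  · intro hN
    obtain ⟨A, B, C, D, h1, h2, h3, h4⟩ := hN.exists_affine hψ hφ hψ0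
    rcases eq_or_ne A 1 with rfl | hA
    · exact Or.inr ⟨B, C, D, fun z => by rw [h1, one_mul], h2, h3⟩
    · exact Or.inl ⟨A, B, C, D, hA, h1, h2, (eq_mul_inv_iff_mul_eq₀ (hconj hA)).2 h4⟩
  · rintro (⟨A, B, C, D, hA, h1, h2, h3⟩ | ⟨B, C, D, h1, h2, h3⟩)
    · have hC : C ≠ 0 := by
        rintro rfl
        obtain ⟨z, hz⟩ := hψ0
        exact hz (by rw [h2, zero_mul])
      obtain rfl : φ = fun z => A * z + B := funext h1
      obtain rfl : ψ = fun z => C * Complex.exp (D * z) := funext h2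
      have hA' : 1 - A ≠ 0 := sub_ne_zero.2 hA.symm
      -- `B / (1 - A)` is the fixed point of `φ`; the formula for `D` says `D = conj a * (1 - A)`.
      refine Fock.isNormalOperator_expWCO_of_fixed (a := B / (1 - A))
        (div_mul_cancel₀ _ hA').symm ?_ hC
      rw [h3, map_div₀, map_sub, map_one]
      ring
    · obtain rfl : φ = fun z => 1 * z + B := funext fun z => by rw [h1, one_mul]
      obtain rfl : ψ = fun z => C * Complex.exp (D * z) := funext h2
      exact Fock.isNormalOperator_expWCO_translation h3
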